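/- **Setting.** Let $(\Omega,\mathcal F,\mathbb P)$ be a probability space and let $(\mathbf X_n)_{n\ge1}$ and $(\mathbf y_n)_{n\ge1}$ be sequences of random elements of $\mathbb R^{N\times Q}$ and $\mathbb R^Q$. Put $\mathcal X_n=\sigma((\mathbf X_k,\mathbf y_k)_{1\le k\le n})$, $\varrho=\mathbb E\|\mathbf y_1\|^2$, $\mathbf r=\mathbb E(\mathbf X_1\mathbf y_1)$, $\mathbf R=\mathbb E(\mathbf X_1\mathbf X_1^\top)$. Let $$\Psi(\mathbf h)=\tfrac12\mathbf h^\top\mathbf V_0\mathbf h-\mathbf v_0^\top\mathbf h+\sum_{s=1}^S\psi_s(\|\mathbf V_s\mathbf h-\mathbf v_s\|),\qquad \mathbf h\in\mathbb R^N,$$ where $\mathbf V_0\in\mathbb R^{N\times N}$ is symmetric positive semi-definite, $\mathbf v_0\in\mathbb R^N$, $\mathbf V_s\in\mathbb R^{P_s\times N}$, $\mathbf v_s\in\mathbb R^{P_s}$ and $\psi_s:\mathbb R\to\mathbb R$, and let $$F(\mathbf h)=\tfrac12\mathbb E\|\mathbf y_1-\mathbf X_1^\top\mathbf h\|^2+\Psi(\mathbf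 h),\qquad F_n(\mathbf h)=\frac1{2n}\sum_{k=1}^n\|\mathbf y_k-\mathbf X_k^\top\mathbf h\|^2+\Psi(\mathbf h).$$ Write $\nu_s(t)=\dot\psi_s(t)/t$, extended by continuity at $t=0$, and $$\mathbf A_n(\mathbf h)=\frac1n\sum_{k=1}^n\mathbf X_k\mathbf X_k^\top+\mathbf V_0+\sum_{s=1}^S\nu_s(\|\mathbf V_s\mathbf h-\mathbf v_s\|)\mathbf V_s^\top\mathbf V_s,$$ $$\Theta_n(\mathbf h',\mathbf h)=F_n(\mathbf h)+\nabla F_n(\mathbf h)^\top(\mathbf h'-\mathbf h)+\tfrac12(\mathbf h'-\mathbf h)^\top\mathbf A_n(\mathbf h)(\mathbf h'-\mathbf h).$$ Let $\mathbf D_n$ be random matrices in $\mathbb R^{N\times M_n}$ and let $(\mathbf h_n)_{n\ge1}$ be random vectors of $\mathbb R^N$ such that, almost surely, for every $n\ge1$, $$\mathbf h_{n+1}\in\operatorname*{arg\,min}_{\mathbf h\in\operatorname{ran}\mathbf D_n}\Theta_n(\mathbf h,\mathbf h_n);$$ where this minimizer is not unique, it is selected non-anticipatively, that is, for each $n$ there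 is an $\mathcal X_n$-measurable random vector with which $\mathbf h_{n+1}$ coincides almost surely on the event that the minimizer is not unique. **Assumptions.** 1. Each $\psi_s$ is even, bounded below and continuously differentiable, $\lim_{t\to0,\,t\ne0}\dot\psi_s(t)/t$ exists in $\mathbb R$, $\psi_s(\sqrt{\cdot})$ is concave on $[0,+\infty)$, and there is $\bar\nu\in[0,+\infty)$ with $0\le\nu_s(t)\le\bar\nu$ for all $s$ and all $t\ge0$. 2. Almost surely, for every $n\ge1$, $\nabla F_n(\mathbf h_n)$ and $\mathbf h_n$ belong to $\operatorname{ran}\mathbf D_n$. 3. (i) $\mathbf R+\mathbf V_0$ is positive definite. (ii) $((\mathbf X_n,\mathbf y_n))_{n\ge1}$ is a stationary ergodic sequence and all entries of $\mathbf X_n$ and $\mathbf y_n$ have finite fourth-order moments. (iii) For every $n\ge1$, almost surely, $\mathbb E(\|\mathbf y_{n+1}\|^2\mid\mathcal X_n)=\varrho$, $\mathbb E(\mathbf X_{n+1}\mathbf y_{n+1}\mid\mathcal X_n)=\mathbf r$ and $\mathbb E(\mathbf X_{n+1}\mathbf X_{n+1}^\top\mid\mathcal X_n)=\mathbf R$.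 (iv) $\mathbf h_1$ is $\mathcal X_1$-measurable and, for every $n\ge1$, $\mathbf D_n$ is $\mathcal X_n$-measurable. **Proposition 2.** Under these assumptions the following hold. (i) Almost surely, the set of cluster points of $(\mathbf h_n)_{n\ge1}$ is a nonempty compact connected set. (ii) Almost surely, every cluster point of $(\mathbf h_n)_{n\ge1}$ is a critical point of $F$, i.e. $F$ is differentiable there with zero gradient. (iii) If all the functions $\psi_s$ are convex, then $F$ has a unique global minimizer and $(\mathbf h_n)_{n\ge1}$ converges almost surely to it. -/

import Mathlib

open MeasureTheory Filter Topology Set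
open scoped Matrix Gradient

noncomputable section

namespace OnlineMM

/-! Sequences indexed by `n ≥ 1` in the mathematics are indexed by `n : ℕ` here, with a shift:
`X n`, `y n`, `h n`, `D n`, ... stand for `X_{n+1}`, `y_{n+1}`, `h_{n+1}`, `D_{n+1}`, ... -/

/-- `ℝ^d` with its Euclidean norm. -/
abbrev Vec (d : ℕ) := EuclideanSpace ℝ (Fin d)

/-- The product `A x` of a matrix with a Euclidean vector. -/
abbrev app {m n : ℕ} (A : Matrix (Fin m) (Fin n) ℝ) (x : Vec n) : Vec m :=
  Matrix.toEuclideanLin A x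

/-- The Borel (product) sigma-algebra on real matrices. -/
instance instMeasurableSpaceMatrix {m n : ℕ} : MeasurableSpace (Matrix (Fin m) (Fin n) ℝ) :=
  inferInstanceAs (MeasurableSpace (Fin m → Fin n → ℝ))

/-- The data of the regularization function
`Ψ(h) = ½ hᵀ V₀ h - v₀ᵀ h + ∑ₛ ψₛ(‖Vₛ h - vₛ‖)`. -/
structure Regularizer (N : ℕ) where
  /-- the number of potential functions -/
  S : ℕ
  V₀ : Matrix (Fin N) (Fin N) ℝ
  /-- `V₀` is symmetric positive semi-definite -/
  posSemidef_V₀ : V₀.PosSemidef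
  v₀ : Vec N
  P : Fin S → ℕ
  V : (s : Fin S) → Matrix (Fin (P s)) (Fin N) ℝ
  v : (s : Fin S) → Vec (P s)
  ψ : Fin S → ℝ → ℝ

/-- `ν(t) = ψ'(t) / t`, extended by continuity at `t = 0`. -/
def weight (ψ : ℝ → ℝ) (t : ℝ) : ℝ :=
  if t = 0 then limUnder (𝓝[≠] (0 : ℝ)) (fun u => deriv ψ u / u) else deriv ψ t / t

namespace Regularizer

variable {N : ℕ} (reg : Regularizer N)

/-- The regularization function `Ψ`. -/
def Ψ (h : Vec N) : ℝ :=
  (1 / 2) * inner ℝ h (app reg.V₀ h) - inner ℝ reg.v₀ h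
    + ∑ s, reg.ψ s ‖app (reg.V s) h - reg.v s‖

/-- Row indices of the stacked matrix `[V₁ᵀ … V_Sᵀ]ᵀ`. -/
abbrev Row := (s : Fin reg.S) × Fin (reg.P s)

/-- The stacked matrix `[V₁ᵀ … V_Sᵀ]ᵀ`. -/
def stack : Matrix reg.Row (Fin N) ℝ :=
  Matrix.of fun i j => reg.V i.1 i.2 j

/-- The vector `b(h)`, equal to `νₛ(‖Vₛ h - vₛ‖)` on the whole `s`-th block. -/
def b (h : Vec N) (i : reg.Row) : ℝ :=
  weight (reg.ψ i.1) ‖app (reg.V i.1) h - reg.v i.1‖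

/-- The conditions on the potential functions `ψₛ`. -/
structure Assumption1 : Prop where
  even : ∀ s t, reg.ψ s (-t) = reg.ψ s t
  bddBelow : ∀ s, BddBelow (range (reg.ψ s))
  contDiff : ∀ s, ContDiff ℝ 1 (reg.ψ s)
  limit_zero : ∀ s, ∃ l : ℝ, Tendsto (fun t => deriv (reg.ψ s) t / t) (𝓝[≠] 0) (𝓝 l)
  concave_sqrt : ∀ s, ConcaveOn ℝ (Ici 0) (fun t => reg.ψ s (Real.sqrt t))
  weight_bounded : ∃ νbar : ℝ, 0 ≤ νbar ∧
    ∀ s t, 0 ≤ t → 0 ≤ weight (reg.ψ s) t ∧ weight (reg.ψ s) t ≤ νbar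

end Regularizer

section Algorithm

variable {N Q : ℕ} (reg : Regularizer N)
  (x : ℕ → Matrix (Fin N) (Fin Q) ℝ) (y : ℕ → Vec Q)

/-- The sample matrix `(1/n) ∑_{k ≤ n} X_k X_kᵀ` (indices shifted, forgetting factor `1`). -/
def sampleR (n : ℕ) : Matrix (Fin N) (Fin N) ℝ :=
  ((n : ℝ) + 1)⁻¹ • ∑ k ∈ Finset.range (n + 1), x k * (x k)ᵀ

/-- The stochastic approximation
`F_n(h) = (1/(2n)) ∑_{k ≤ n} ‖y_k - X_kᵀ h‖² + Ψ(h)` (indices shifted, forgetting factor `1`). -/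
def sampleCost (n : ℕ) (h : Vec N) : ℝ :=
  (2 * ((n : ℝ) + 1))⁻¹ * ∑ k ∈ Finset.range (n + 1), ‖y k - app (x k)ᵀ h‖ ^ 2 + reg.Ψ h

/-- The curvature matrix `A_n(h) = R_n + V₀ + Vᵀ Diag(b(h)) V`. -/
def curvature (n : ℕ) (h : Vec N) : Matrix (Fin N) (Fin N) ℝ :=
  sampleR x n + reg.V₀ + reg.stackᵀ * Matrix.diagonal (reg.b h) * reg.stack

/-- The quadratic surrogate `Θ_n(h', h)`. -/
def surrogate (n : ℕ) (h' h : Vec N) : ℝ :=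
  sampleCost reg x y n h + inner ℝ (∇ (sampleCost reg x y n) h) (h' - h)
    + (1 / 2) * inner ℝ (h' - h) (app (curvature reg x n h) (h' - h))

/-- The range of a matrix. -/
abbrev ran {M : ℕ} (D : Matrix (Fin N) (Fin M) ℝ) : Submodule ℝ (Vec N) :=
  LinearMap.range (Matrix.toEuclideanLin D)

/-- The set of minimizers of `Θ_n(·, h)` over `ran D`. -/
def argminSurrogate (n : ℕ) (h : Vec N) {M : ℕ} (D : Matrix (Fin N) (Fin M) ℝ) : Set (Vec N) :=
  {z | z ∈ ran D ∧ ∀ z' ∈ ran D, surrogate reg x y n z h ≤ surrogate reg x y n z' h}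

end Algorithm

section Stochastic

variable {Ω : Type*} {N Q : ℕ}
  (X : ℕ → Ω → Matrix (Fin N) (Fin Q) ℝ) (y : ℕ → Ω → Vec Q)

/-- The sigma-algebra generated by the first observations `(X_k, y_k)`, `k ≤ n`. -/
@[reducible]
def dataSigma (n : ℕ) : MeasurableSpace Ω :=
  ⨆ (k : ℕ) (_ : k ≤ n), MeasurableSpace.comap (fun ω => (X k ω, y k ω)) inferInstance

variable [MeasurableSpace Ω] (μ : Measure Ω) (reg : Regularizer N)

/-- `ϱ = E ‖y‖²`. -/
def momentY : ℝ := ∫ ω, ‖y 0 ω‖ ^ 2 ∂μ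

/-- `r = E (X y)`. -/
def momentXY : Vec N := WithLp.toLp 2 fun i => ∫ ω, app (X 0 ω) (y 0 ω) i ∂μ

/-- `R = E (X Xᵀ)`. -/
def momentXX : Matrix (Fin N) (Fin N) ℝ :=
  Matrix.of fun i j => ∫ ω, (X 0 ω * (X 0 ω)ᵀ) i j ∂μ

/-- The limit cost `F(h) = ½ E ‖y - Xᵀ h‖² + Ψ(h)`. -/
def cost (h : Vec N) : ℝ := (1 / 2) * ∫ ω, ‖y 0 ω - app (X 0 ω)ᵀ h‖ ^ 2 ∂μ + reg.Ψ h

/-- `((X_n, y_n))_n` is a stationary ergodic sequence: its law on the space of sequences is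
invariant and ergodic under the shift. -/
def IsStationaryErgodic : Prop :=
  Ergodic (fun (z : ℕ → Matrix (Fin N) (Fin Q) ℝ × Vec Q) n => z (n + 1))
    (μ.map fun ω n => (X n ω, y n ω))

variable (M : ℕ → ℕ) (D : (n : ℕ) → Ω → Matrix (Fin N) (Fin (M n)) ℝ) (h : ℕ → Ω → Vec N)

/-- `(h_n)` is generated by the online MM subspace algorithm,
`h_{n+1} ∈ argmin_{ran D_n} Θ_n(·, h_n)`. Whenever this argmin is not a singleton, the choice of
`h_{n+1}` in it is non-anticipative, i.e. given by a random vector that is measurable with respect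
to the first `n` observations. -/
structure IsMMSubspaceSequence : Prop where
  mem_argmin : ∀ᵐ ω ∂μ, ∀ n,
    h (n + 1) ω ∈ argminSurrogate reg (X · ω) (y · ω) n (h n ω) (D n ω)
  selection : ∀ n, ∃ g : Ω → Vec N, Measurable[dataSigma X y n] g ∧
    ∀ᵐ ω ∂μ, ¬ (argminSurrogate reg (X · ω) (y · ω) n (h n ω) (D n ω)).Subsingleton →
      h (n + 1) ω = g ω

/-- The subspaces contain the current gradient and the current iterate. -/
def Assumption2 : Prop :=
  ∀ᵐ ω ∂μ, ∀ n,
    ∇ (sampleCost reg (X · ω) (y · ω) n) (h n ω) ∈ ran (D n ω) ∧ h n ω ∈ ran (D n ω)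

/-- The probabilistic conditions on the observations and on the algorithm. -/
structure Assumption3 : Prop where
  posDef : (momentXX X μ + reg.V₀).PosDef
  stationary_ergodic : IsStationaryErgodic X y μ
  moment_X : ∀ n i j, MemLp (fun ω => X n ω i j) 4 μ
  moment_y : ∀ n i, MemLp (fun ω => y n ω i) 4 μ
  condExp_y : ∀ n, μ[fun ω => ‖y (n + 1) ω‖ ^ 2 | dataSigma X y n] =ᵐ[μ] fun _ => momentY y μ
  condExp_Xy : ∀ n i, μ[fun ω => app (X (n + 1) ω) (y (n + 1) ω) i | dataSigma X y n]
    =ᵐ[μ] fun _ => momentXY X y μ i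
  condExp_XX : ∀ n i j, μ[fun ω => (X (n + 1) ω * (X (n + 1) ω)ᵀ) i j | dataSigma X y n]
    =ᵐ[μ] fun _ => momentXX X μ i j
  measurable_init : Measurable[dataSigma X y 0] (h 0)
  measurable_D : ∀ n i j, Measurable[dataSigma X y n] (fun ω => D n ω i j)

end Stochastic

/-- The set of cluster points of a sequence. -/
def clusterPoints {E : Type*} [TopologicalSpace E] (u : ℕ → E) : Set E :=
  {z | MapClusterPt z atTop u}

end OnlineMM

end

/-!
Each step minimizes a quadratic majorant of `F_n` over a subspace that contains the current iterate
and the current gradient. Hence `F_n` decreases by a multiple of `‖h_{n+1} - h_n‖²`, and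
`‖∇F_n(h_n)‖` is at most a multiple of `‖h_{n+1} - h_n‖`. The inequalities telescope except for the
terms `(F_{n+1} - F_n)(h_{n+1})`, which are linear combinations of increments of sample means whose
coefficients are bounded non-anticipative functions of the iterates. If `m_n` is the sample mean of
the martingale differences `ξ_k`, then `m_{n+1} - m_n = (ξ_{n+1} - m_n) / (n + 1)`. The partial sums
of the weighted `ξ_{n+1} / (n + 1)` converge almost surely by `L²` martingale convergence, and those
of `|m_n| / (n + 1)` because `E |m_n| = O(n^{-1/2})`. Thus `∑ ‖h_{n+1} - h_n‖² < ∞`, so that the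
increments and the gradients tend to zero: the cluster set is connected and its points are critical.

The iterates are non-anticipative because a unique minimizer over `ran D_n` is the limit of Tikhonov
regularized minimizers, which are explicit measurable functions of the data.
-/

namespace OnlineMM

theorem tangent_le_of_convexOn {f : ℝ → ℝ} {S : Set ℝ} (hf : ConvexOn ℝ S f) {x y f' : ℝ}
    (hx : x ∈ S) (hy : y ∈ S) (hd : HasDerivAt f f' x) : f x + f' * (y - x) ≤ f y := by
  rcases lt_trichotomy x y with hxy | rfl | hxy
  · have := hf.le_slope_of_hasDerivAt hx hy hxy hd
    rw [slope_def_field, le_div_iff₀ (by linarith)] at this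
    linarith
  · simp
  · have := hf.slope_le_of_hasDerivAt hy hx hxy hd
    rw [slope_def_field, div_le_iff₀ (by linarith)] at this
    linarith

theorem le_tangent_of_concaveOn {f : ℝ → ℝ} {S : Set ℝ} (hf : ConcaveOn ℝ S f) {x y f' : ℝ}
    (hx : x ∈ S) (hy : y ∈ S) (hd : HasDerivAt f f' x) : f y ≤ f x + f' * (y - x) := by
  have := tangent_le_of_convexOn hf.neg hx hy hd.neg
  simp only [Pi.neg_apply] at this
  linarith

/-- The conditions on a potential `ψ` under which `ψ ∘ ‖·‖` has half-quadratic majorants: its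
weight `ψ'(t) / t` is continuous, nonnegative, and nonincreasing on `[0, ∞)`. -/
structure IsPotential (ψ : ℝ → ℝ) : Prop where
  contDiff : ContDiff ℝ 1 ψ
  limit_zero : ∃ l : ℝ, Tendsto (fun t => deriv ψ t / t) (𝓝[≠] 0) (𝓝 l)
  concave_sqrt : ConcaveOn ℝ (Ici 0) (fun t => ψ (Real.sqrt t))
  weight_nonneg : ∀ t, 0 ≤ t → 0 ≤ weight ψ t

namespace IsPotential

variable {ψ : ℝ → ℝ} (hψ : IsPotential ψ)
include hψ

theorem hasDerivAt (t : ℝ) : HasDerivAt ψ (deriv ψ t) t :=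
  (hψ.contDiff.differentiable one_ne_zero t).hasDerivAt

theorem continuous_deriv : Continuous (deriv ψ) :=
  hψ.contDiff.continuous_deriv le_rfl

theorem tendsto_weight_zero :
    Tendsto (fun t => deriv ψ t / t) (𝓝[≠] 0) (𝓝 (weight ψ 0)) := by
  simpa [weight] using tendsto_nhds_limUnder hψ.limit_zero

theorem deriv_zero : deriv ψ 0 = 0 := by
  have hprod : Tendsto (fun t => deriv ψ t / t * t) (𝓝[≠] 0) (𝓝 (weight ψ 0 * 0)) :=
    hψ.tendsto_weight_zero.mul nhdsWithin_le_nhds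
  rw [mul_zero] at hprod
  refine tendsto_nhds_unique (hψ.continuous_deriv.tendsto 0 |>.mono_left nhdsWithin_le_nhds)
    (hprod.congr' ?_)
  filter_upwards [self_mem_nhdsWithin] with t ht using div_mul_cancel₀ _ ht

theorem deriv_eq (t : ℝ) : deriv ψ t = weight ψ t * t := by
  unfold weight
  split_ifs with h
  · simp [h, hψ.deriv_zero]
  · field_simp

theorem continuous_weight : Continuous (weight ψ) := by
  rw [continuous_iff_continuousAt]
  intro t
  by_cases ht : t = 0
  · subst ht
    rw [continuousAt_iff_punctured_nhds]
    refine hψ.tendsto_weight_zero.congr' ?_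
    filter_upwards [self_mem_nhdsWithin] with t ht
    simp only [mem_compl_iff, mem_singleton_iff] at ht
    simp [weight, ht]
  · refine (hψ.continuous_deriv.continuousAt.div continuousAt_id ht).congr ?_
    filter_upwards [isOpen_ne.mem_nhds ht] with u hu
    simp [weight, show u ≠ 0 from hu]

theorem hasDerivAt_comp_sqrt {t : ℝ} (ht : 0 < t) :
    HasDerivAt (fun u => ψ (Real.sqrt u)) (weight ψ t / 2) (t ^ 2) := by
  have hs : Real.sqrt (t ^ 2) = t := Real.sqrt_sq ht.le
  have hd : HasDerivAt ψ (deriv ψ t) (Real.sqrt (t ^ 2)) := hs.symm ▸ hψ.hasDerivAt t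
  refine (hd.comp (t ^ 2) (Real.hasDerivAt_sqrt (pow_pos ht 2).ne')).congr_deriv ?_
  rw [hs, hψ.deriv_eq]
  field_simp

theorem le_quadratic {t t' : ℝ} (ht : 0 ≤ t) (ht' : 0 ≤ t') :
    ψ t' ≤ ψ t + weight ψ t / 2 * (t' ^ 2 - t ^ 2) := by
  have hpos : ∀ t : ℝ, 0 < t → ψ t' ≤ ψ t + weight ψ t / 2 * (t' ^ 2 - t ^ 2) := fun t ht => by
    simpa [Real.sqrt_sq ht.le, Real.sqrt_sq ht'] using
      le_tangent_of_concaveOn hψ.concave_sqrt (y := t' ^ 2) (mem_Ici.2 (sq_nonneg t))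
        (mem_Ici.2 (sq_nonneg _)) (hψ.hasDerivAt_comp_sqrt ht)
  rcases ht.eq_or_lt with rfl | ht
  · have hc : Continuous fun t => ψ t + weight ψ t / 2 * (t' ^ 2 - t ^ 2) := by
      have := hψ.continuous_weight
      have := hψ.contDiff.continuous
      fun_prop
    refine ge_of_tendsto ((hc.tendsto 0).mono_left (nhdsWithin_le_nhds (s := Ioi 0))) ?_
    filter_upwards [self_mem_nhdsWithin] with t ht using hpos t ht
  · exact hpos t ht

theorem antitoneOn_weight : AntitoneOn (weight ψ) (Ici 0) := by
  intro t ht t' ht' htt'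
  rcases htt'.eq_or_lt with rfl | hlt
  · exact le_rfl
  · have hsq : 0 < t' ^ 2 - t ^ 2 := sub_pos.2 (pow_lt_pow_left₀ hlt ht two_ne_zero)
    nlinarith [hψ.le_quadratic ht ht', hψ.le_quadratic ht' ht]

variable {F : Type*} [NormedAddCommGroup F] [InnerProductSpace ℝ F]

theorem hasFDerivAt_comp_norm (w : F) :
    HasFDerivAt (fun w => ψ ‖w‖) (weight ψ ‖w‖ • innerSL ℝ w) w := by
  by_cases hw : w = 0
  · subst hw
    have hd := hψ.hasDerivAt 0
    rw [hψ.deriv_zero, hasDerivAt_iff_isLittleO_nhds_zero] at hd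
    rw [hasFDerivAt_iff_isLittleO_nhds_zero]
    have hn : Tendsto (fun w : F => ‖w‖) (𝓝 0) (𝓝 0) := tendsto_norm_zero
    simpa [Function.comp_def] using (hd.comp_tendsto hn).of_norm_right
  · have hd := (hψ.hasDerivAt ‖w‖).comp_hasFDerivAt w
      (hasStrictFDerivAt_norm_sq w |>.hasFDerivAt.sqrt (by simpa using hw) |>.congr_of_eventuallyEq
        (f₁ := fun w : F => ‖w‖) (Eventually.of_forall fun w => by simp))
    refine hd.congr_fderiv ?_
    have hw' : ‖w‖ ≠ 0 := norm_ne_zero_iff.2 hw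
    ext x
    simp only [hψ.deriv_eq, norm_nonneg, Real.sqrt_sq, one_div, mul_inv_rev, smul_apply,
      coe_innerSL_apply, nsmul_eq_mul, Nat.cast_ofNat, smul_eq_mul]
    field_simp

theorem comp_norm_le (w w' : F) :
    ψ ‖w'‖ ≤ ψ ‖w‖ + weight ψ ‖w‖ * inner ℝ w (w' - w)
      + 1 / 2 * (weight ψ ‖w‖ * ‖w' - w‖ ^ 2) := by
  have h := hψ.le_quadratic (norm_nonneg w) (norm_nonneg w')
  have h2 : ‖w'‖ ^ 2 = ‖w‖ ^ 2 + 2 * inner ℝ w (w' - w) + ‖w' - w‖ ^ 2 := by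
    rw [← norm_add_sq_real]; simp
  rw [h2] at h
  linarith

theorem le_comp_norm_of_convexOn (hc : ConvexOn ℝ univ ψ) (w w' : F) :
    ψ ‖w‖ + weight ψ ‖w‖ * inner ℝ w (w' - w) ≤ ψ ‖w'‖ := by
  have h := tangent_le_of_convexOn hc (mem_univ ‖w‖) (mem_univ ‖w'‖) (hψ.hasDerivAt ‖w‖)
  rw [hψ.deriv_eq, mul_assoc] at h
  refine le_trans ?_ h
  gcongr
  · exact hψ.weight_nonneg _ (norm_nonneg _)
  · rw [inner_sub_right, real_inner_self_eq_norm_sq]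
    nlinarith [real_inner_le_norm w w']

end IsPotential

section Penalty

variable {ι : Type*} [Fintype ι] {E : Type*} [NormedAddCommGroup E] [InnerProductSpace ℝ E]
  [CompleteSpace E] {F : ι → Type*} [∀ s, NormedAddCommGroup (F s)]
  [∀ s, InnerProductSpace ℝ (F s)] [∀ s, CompleteSpace (F s)]
  (ψ : ι → ℝ → ℝ) (L : ∀ s, E →L[ℝ] F s) (v : ∀ s, F s)

/-- The penalty `∑ₛ ψₛ(‖Lₛ h - vₛ‖)` for bounded operators `Lₛ`. -/
noncomputable def penalty (h : E) : ℝ := ∑ s, ψ s ‖L s h - v s‖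

/-- The operator `∑ₛ νₛ(‖Lₛ h - vₛ‖) Lₛ* Lₛ`, which is both the curvature of the half-quadratic
majorant of `penalty` at `h` and the linear part of its gradient. -/
noncomputable def penaltyOp (h : E) : E →L[ℝ] E :=
  ∑ s, weight (ψ s) ‖L s h - v s‖ • (L s).adjoint ∘L L s

/-- The vector `∑ₛ νₛ(‖Lₛ h - vₛ‖) Lₛ* vₛ`, so that the gradient of `penalty` at `h` is
`penaltyOp h h - penaltyVec h`. -/
noncomputable def penaltyVec (h : E) : E :=
  ∑ s, weight (ψ s) ‖L s h - v s‖ • (L s).adjoint (v s)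

variable {ψ L v}

theorem inner_penaltyOp (h x z : E) : inner ℝ x (penaltyOp ψ L v h z)
    = ∑ s, weight (ψ s) ‖L s h - v s‖ * inner ℝ (L s x) (L s z) := by
  simp [penaltyOp, inner_sum, inner_smul_right,
    ContinuousLinearMap.adjoint_inner_right]

theorem inner_penaltyOp_sub_penaltyVec (h x : E) :
    inner ℝ (penaltyOp ψ L v h h - penaltyVec ψ L v h) x
      = ∑ s, weight (ψ s) ‖L s h - v s‖ * inner ℝ (L s h - v s) (L s x) := by
  rw [real_inner_comm, inner_sub_right, inner_penaltyOp]
  simp only [penaltyVec, inner_sum, inner_smul_right, ContinuousLinearMap.adjoint_inner_right,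
    ← Finset.sum_sub_distrib, ← mul_sub, ← inner_sub_right]
  simp only [real_inner_comm]

variable (hψ : ∀ s, IsPotential (ψ s))
include hψ

theorem hasGradientAt_penalty (h : E) :
    HasGradientAt (penalty ψ L v) (penaltyOp ψ L v h h - penaltyVec ψ L v h) h := by
  rw [hasGradientAt_iff_hasFDerivAt]
  have : HasFDerivAt (penalty ψ L v) (∑ s, (weight (ψ s) ‖L s h - v s‖ •
      innerSL ℝ (L s h - v s)).comp (L s)) h := by
    refine HasFDerivAt.fun_sum fun s _ => ?_
    exact ((hψ s).hasFDerivAt_comp_norm _).comp h ((L s).hasFDerivAt.sub_const _)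
  refine this.congr_fderiv ?_
  ext x
  rw [InnerProductSpace.toDual_apply_apply, inner_penaltyOp_sub_penaltyVec]
  simp [inner_sub_left]

theorem penalty_le (h h' : E) : penalty ψ L v h' ≤ penalty ψ L v h
    + inner ℝ (penaltyOp ψ L v h h - penaltyVec ψ L v h) (h' - h)
    + 1 / 2 * inner ℝ (h' - h) (penaltyOp ψ L v h (h' - h)) := by
  rw [inner_penaltyOp_sub_penaltyVec, inner_penaltyOp, Finset.mul_sum, penalty, penalty,
    ← Finset.sum_add_distrib, ← Finset.sum_add_distrib]
  refine Finset.sum_le_sum fun s _ => ?_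
  have := (hψ s).comp_norm_le (L s h - v s) (L s h' - v s)
  rwa [sub_sub_sub_cancel_right, ← map_sub, ← real_inner_self_eq_norm_sq] at this

theorem le_penalty_of_convexOn (hc : ∀ s, ConvexOn ℝ univ (ψ s)) (h h' : E) :
    penalty ψ L v h + inner ℝ (penaltyOp ψ L v h h - penaltyVec ψ L v h) (h' - h)
      ≤ penalty ψ L v h' := by
  rw [inner_penaltyOp_sub_penaltyVec, penalty, penalty, ← Finset.sum_add_distrib]
  refine Finset.sum_le_sum fun s _ => ?_
  have := (hψ s).le_comp_norm_of_convexOn (hc s) (L s h - v s) (L s h' - v s)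
  rwa [sub_sub_sub_cancel_right, ← map_sub] at this

omit [CompleteSpace E] [∀ s, CompleteSpace (F s)] in
theorem continuous_penalty : Continuous (penalty ψ L v) := by
  have := fun s => (hψ s).contDiff.continuous
  unfold penalty
  fun_prop

theorem continuous_penaltyOp : Continuous (penaltyOp ψ L v) := by
  have := fun s => (hψ s).continuous_weight
  unfold penaltyOp
  fun_prop

theorem continuous_penaltyVec : Continuous (penaltyVec ψ L v) := by
  have := fun s => (hψ s).continuous_weight
  unfold penaltyVec
  fun_prop

theorem inner_penaltyOp_nonneg (h x : E) : 0 ≤ inner ℝ x (penaltyOp ψ L v h x) := by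
  rw [inner_penaltyOp]
  exact Finset.sum_nonneg fun s _ => mul_nonneg ((hψ s).weight_nonneg _ (norm_nonneg _))
    real_inner_self_nonneg

theorem norm_penaltyVec_le (h : E) :
    ‖penaltyVec ψ L v h‖ ≤ ∑ s, weight (ψ s) 0 * ‖(L s).adjoint (v s)‖ := by
  refine norm_sum_le_of_le _ fun s _ => ?_
  rw [norm_smul, Real.norm_of_nonneg ((hψ s).weight_nonneg _ (norm_nonneg _))]
  gcongr
  exact (hψ s).antitoneOn_weight self_mem_Ici (norm_nonneg _) (norm_nonneg _)

end Penalty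

section ClusterPoints

theorem isClosed_clusterPoints {E : Type*} [TopologicalSpace E] (u : ℕ → E) :
    IsClosed (clusterPoints u) :=
  isClosed_setOfPred_clusterPt

theorem clusterPoints_subset_closure_range {E : Type*} [TopologicalSpace E] (u : ℕ → E) :
    clusterPoints u ⊆ closure (range u) := by
  intro z hz
  rw [mem_closure_iff_clusterPt]
  exact ClusterPt.mono hz (le_principal_iff.2 range_mem_map)

theorem frequently_mem_Icc_of_increments {s : ℕ → ℝ} {a b : ℝ}
    (hs : ∀ᶠ n in atTop, s (n + 1) - s n ≤ b - a) (hab : a ≤ b)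
    (ha : ∃ᶠ n in atTop, s n < a) (hb : ∃ᶠ n in atTop, b < s n) :
    ∃ᶠ n in atTop, s n ∈ Icc a b := by
  rw [frequently_atTop] at *
  obtain ⟨n₀, hn₀⟩ := eventually_atTop.1 hs
  intro n₁
  obtain ⟨n, hn, hsn⟩ := ha (max n₀ n₁)
  obtain ⟨m, hnm, hsm⟩ := hb n
  obtain ⟨k, hk, hk'⟩ : ∃ k, ¬ a ≤ s (n + k) ∧ a ≤ s (n + (k + 1)) :=
    Nat.exists_not_and_succ_of_not_zero_of_exists (p := fun k => a ≤ s (n + k)) (not_le.2 hsn)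
      ⟨m - n, by rw [Nat.add_sub_cancel' hnm]; linarith⟩
  exact ⟨n + k + 1, by omega, hk', by linarith [hn₀ (n + k) (by omega)]⟩

variable {E : Type*} [PseudoMetricSpace E] [ProperSpace E] {u : ℕ → E}
  (hu : Bornology.IsBounded (range u))
include hu

theorem nonempty_clusterPoints : (clusterPoints u).Nonempty := by
  obtain ⟨z, -, hz⟩ := hu.isCompact_closure.exists_mapClusterPt (f := atTop) (u := u)
    (tendsto_principal.2 (Eventually.of_forall fun n => subset_closure (mem_range_self n)))
  exact ⟨z, hz⟩

theorem isCompact_clusterPoints : IsCompact (clusterPoints u) :=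
  hu.isCompact_closure.of_isClosed_subset (isClosed_clusterPoints u)
    (clusterPoints_subset_closure_range u)

theorem tendsto_of_clusterPoints_subset_singleton {z : E} (h : clusterPoints u ⊆ {z}) :
    Tendsto u atTop (𝓝 z) :=
  hu.isCompact_closure.tendsto_nhds_of_unique_mapClusterPt
    (Eventually.of_forall fun n => subset_closure (mem_range_self n)) fun _ _ hz => h hz

variable (hd : Tendsto (fun n => dist (u (n + 1)) (u n)) atTop (𝓝 0))
include hd

theorem exists_clusterPoint_mem_Icc {f : E → ℝ} (hf : Continuous f) {a b : ℝ} (hab : a < b)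
    {z z' : E} (hz : z ∈ clusterPoints u) (hza : f z < a) (hz' : z' ∈ clusterPoints u)
    (hzb : b < f z') : ∃ w ∈ clusterPoints u, f w ∈ Icc a b := by
  have hmem : ∀ n, u n ∈ closure (range u) := fun n => subset_closure (mem_range_self n)
  have hinc : ∀ᶠ n in atTop, f (u (n + 1)) - f (u n) ≤ b - a := by
    obtain ⟨δ, hδ, hfδ⟩ := Metric.uniformContinuousOn_iff.1
      (hu.isCompact_closure.uniformContinuousOn_of_continuous hf.continuousOn) _ (sub_pos.2 hab)
    filter_upwards [hd.eventually (gt_mem_nhds hδ)] with n hn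
    exact (le_abs_self _).trans (hfδ _ (hmem _) _ (hmem _) hn).le
  have hfreq : ∃ᶠ n in atTop, f (u n) ∈ Icc a b :=
    frequently_mem_Icc_of_increments hinc hab.le
      (mapClusterPt_iff_frequently.1 hz _ (hf.continuousAt.eventually (gt_mem_nhds hza)))
      (mapClusterPt_iff_frequently.1 hz' _ (hf.continuousAt.eventually (lt_mem_nhds hzb)))
  have hcomp : IsCompact (closure (range u) ∩ f ⁻¹' Icc a b) :=
    hu.isCompact_closure.inter_right (isClosed_Icc.preimage hf)
  obtain ⟨w, hwm, hw⟩ := hcomp.exists_mapClusterPt_of_frequently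
    (hfreq.mono fun n hn => ⟨hmem n, hn⟩)
  exact ⟨w, hw, hwm.2⟩

theorem isPreconnected_clusterPoints : IsPreconnected (clusterPoints u) := by
  rw [isPreconnected_closed_iff]
  rintro t t' ht ht' hsub ⟨z, hz, hzt⟩ ⟨z', hz', hzt'⟩
  by_contra hdisj
  have hclosed := isClosed_clusterPoints u
  obtain ⟨f, hf0, hf1, -⟩ := exists_continuous_zero_one_of_isClosed (hclosed.inter ht)
    (hclosed.inter ht') (Set.disjoint_left.2 fun x hx hx' => hdisj ⟨x, hx.1, hx.2, hx'.2⟩)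
  obtain ⟨w, hw, hfw⟩ := exists_clusterPoint_mem_Icc hu hd f.continuous
    (a := 1 / 3) (b := 2 / 3) (by norm_num) hz (by rw [hf0 ⟨hz, hzt⟩]; norm_num) hz'
    (by rw [hf1 ⟨hz', hzt'⟩]; norm_num)
  rcases hsub hw with hwt | hwt
  · rw [hf0 ⟨hw, hwt⟩] at hfw
    norm_num at hfw
  · rw [hf1 ⟨hw, hwt⟩] at hfw
    norm_num at hfw

end ClusterPoints

section Quadratic

variable {E : Type*} [NormedAddCommGroup E] [InnerProductSpace ℝ E]

/-- The quadratic function `x ↦ ½⟨x, B x⟩ - ⟨c, x⟩`; for symmetric `B` its gradient is `B x - c`. -/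
noncomputable def quadratic (B : E →L[ℝ] E) (c x : E) : ℝ :=
  1 / 2 * inner ℝ x (B x) - inner ℝ c x

theorem quadratic_sub (B B' : E →L[ℝ] E) (c c' x : E) :
    quadratic (B - B') (c - c') x = quadratic B c x - quadratic B' c' x := by
  simp only [quadratic, sub_apply, inner_sub_left, inner_sub_right]
  ring

section Symmetric

variable {B : E →L[ℝ] E} (hB : B.IsSymmetric) (c : E)
include hB

theorem quadratic_expansion (x z : E) :
    quadratic B c z
      = quadratic B c x + inner ℝ (B x - c) (z - x) + 1 / 2 * inner ℝ (z - x) (B (z - x)) := by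
  have hxz : inner ℝ x (B z) = inner ℝ z (B x) := by rw [← hB.apply_clm, real_inner_comm]
  simp only [quadratic, inner_sub_left, inner_sub_right, map_sub, hB.apply_clm]
  linarith

theorem hasGradientAt_quadratic [CompleteSpace E] (x : E) :
    HasGradientAt (quadratic B c) (B x - c) x := by
  rw [hasGradientAt_iff_hasFDerivAt]
  have hd := (((hasFDerivAt_id x).inner ℝ (B.hasFDerivAt (x := x))).const_mul (1 / 2 : ℝ)).sub
    ((innerSL ℝ c).hasFDerivAt (x := x))
  refine hd.congr_fderiv ?_
  ext z
  have hxz : inner ℝ x (B z) = inner ℝ z (B x) := by rw [← hB.apply_clm, real_inner_comm]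
  simp only [id_eq, sub_apply, smul_apply, ContinuousLinearMap.comp_apply,
    ContinuousLinearMap.prod_apply, ContinuousLinearMap.id_apply, fderivInnerCLM_apply,
    coe_innerSL_apply, smul_eq_mul, InnerProductSpace.toDual_apply_apply, inner_sub_left,
    hxz, real_inner_comm z (B x)]
  ring

theorem quadratic_add_lt_of_critical {Φ : E → ℝ} {g z : E} {α : ℝ} (hα : 0 < α)
    (hpos : ∀ x, α * ‖x‖ ^ 2 ≤ inner ℝ x (B x))
    (hΦ : ∀ z', Φ z + inner ℝ g (z' - z) ≤ Φ z') (hz : B z - c + g = 0) {z' : E}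
    (hne : z' ≠ z) : quadratic B c z + Φ z < quadratic B c z' + Φ z' := by
  have hcrit : inner ℝ (B z - c) (z' - z) + inner ℝ g (z' - z) = 0 := by
    rw [← inner_add_left, hz, inner_zero_left]
  have hgap : 0 < α * ‖z' - z‖ ^ 2 := by
    have : 0 < ‖z' - z‖ := norm_pos_iff.2 (sub_ne_zero.2 hne)
    positivity
  linarith [quadratic_expansion hB c z z', hpos (z' - z), hΦ z']

end Symmetric

theorem forall_quadratic_le_iff {A : E →L[ℝ] E} (hA : A.IsPositive) (c : E) {W : Submodule ℝ E}
    {z : E} (hz : z ∈ W) :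
    (∀ z' ∈ W, quadratic A c z ≤ quadratic A c z') ↔ ∀ w ∈ W, inner ℝ (A z - c) w = 0 := by
  refine ⟨fun hmin w hw => ?_, fun horth z' hz' => ?_⟩
  · have hnonneg : ∀ t : ℝ,
        0 ≤ 1 / 2 * inner ℝ w (A w) * (t * t) + inner ℝ (A z - c) w * t + 0 := fun t => by
      have hle := hmin (z + t • w) (W.add_mem hz (W.smul_mem t hw))
      rw [quadratic_expansion hA.isSymmetric c z (z + t • w), add_sub_cancel_left, map_smul] at hle
      simp only [inner_smul_left, inner_smul_right, conj_trivial] at hle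
      linarith
    simpa [discrim, sq_nonpos_iff] using discrim_le_zero hnonneg
  · have horth' := horth _ (W.sub_mem hz' hz)
    linarith [quadratic_expansion hA.isSymmetric c z z', hA.inner_nonneg_right (z' - z)]

theorem eventually_coercive {ι : Type*} {l : Filter ι} {B : ι → E →L[ℝ] E} {B' : E →L[ℝ] E}
    {α : ℝ} (hα : 0 < α) (hB : Tendsto B l (𝓝 B')) (hpos : ∀ x, α * ‖x‖ ^ 2 ≤ inner ℝ x (B' x)) :
    ∀ᶠ n in l, ∀ x, α / 2 * ‖x‖ ^ 2 ≤ inner ℝ x (B n x) := by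
  have hnorm : Tendsto (fun n => ‖B n - B'‖) l (𝓝 0) := tendsto_iff_norm_sub_tendsto_zero.1 hB
  filter_upwards [hnorm.eventually (gt_mem_nhds (half_pos hα))] with n hn x
  have hdiff : -inner ℝ x ((B n - B') x) ≤ α / 2 * ‖x‖ ^ 2 :=
    calc -inner ℝ x ((B n - B') x) ≤ ‖x‖ * ‖(B n - B') x‖ :=
          (neg_le_abs _).trans (abs_real_inner_le_norm _ _)
      _ ≤ ‖x‖ * (α / 2 * ‖x‖) := by gcongr; exact (B n - B').le_of_opNorm_le hn.le x
      _ = α / 2 * ‖x‖ ^ 2 := by ring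
  rw [sub_apply, inner_sub_right] at hdiff
  linarith [hpos x]

end Quadratic

theorem summable_of_le_sub_succ_add {a G e : ℕ → ℝ} (ha : ∀ n, 0 ≤ a n)
    (hG : ∃ K, ∀ᶠ n in atTop, K ≤ G n) (he : ∃ K, ∀ m, |∑ n ∈ Finset.range m, e n| ≤ K)
    (h : ∀ᶠ n in atTop, a n ≤ G n - G (n + 1) + e n) : Summable a := by
  obtain ⟨K, hK⟩ := hG
  obtain ⟨C, hC⟩ := he
  obtain ⟨n₀, hn₀⟩ := eventually_atTop.1 (hK.and h)
  rw [← summable_nat_add_iff n₀]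
  refine summable_of_sum_range_le (c := G n₀ - K + 2 * C) (fun n => ha _) fun m => ?_
  have htele : ∑ n ∈ Finset.range m, a (n + n₀) ≤ G n₀ - G (m + n₀)
      + (∑ n ∈ Finset.range (m + n₀), e n - ∑ n ∈ Finset.range n₀, e n) := by
    induction m with
    | zero => simp
    | succ m ih =>
      rw [Finset.sum_range_succ, Nat.add_right_comm, Finset.sum_range_succ]
      linarith [(hn₀ (m + n₀) (by omega)).2]
  linarith [(hn₀ (m + n₀) (by omega)).1, abs_le.1 (hC (m + n₀)), abs_le.1 (hC n₀)]

section Trajectory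

variable {E : Type*} [NormedAddCommGroup E] [InnerProductSpace ℝ E]

/-- `Φ` lies below a quadratic function that is tangent to it at each point `h`, with positive
curvature `P h` and gradient `P h h - p h`, where `p` is bounded. -/
structure IsQuadraticallyMajorized (Φ : E → ℝ) (P : E → E →L[ℝ] E) (p : E → E) : Prop where
  nonneg : ∀ h x, 0 ≤ inner ℝ x (P h x)
  le : ∀ h h', Φ h' ≤ Φ h + inner ℝ (P h h - p h) (h' - h) + 1 / 2 * inner ℝ (h' - h) (P h (h' - h))
  continuous : Continuous Φ
  continuous_op : Continuous P
  continuous_vec : Continuous p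
  bounded_vec : ∃ C, ∀ h, ‖p h‖ ≤ C

/-- `h` is generated by the majorize-minimize subspace algorithm for the costs
`quadratic (B n) (c n) + Φ`, where `Φ` is majorized through `P` and `p`: the iterate `h (n + 1)`
satisfies the normal equations of the majorant at `h n` on a subspace `W n` that contains `h n` and
the gradient at `h n`. -/
structure IsSubspaceDescent (P : E → E →L[ℝ] E) (p : E → E) (B : ℕ → E →L[ℝ] E) (c : ℕ → E)
    (W : ℕ → Submodule ℝ E) (h : ℕ → E) : Prop where
  symm : ∀ n, (B n).IsSymmetric
  mem : ∀ n, h n ∈ W n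
  mem_succ : ∀ n, h (n + 1) ∈ W n
  gradient_mem : ∀ n, B n (h n) - c n + (P (h n) (h n) - p (h n)) ∈ W n
  orthogonal : ∀ n, ∀ w ∈ W n,
    inner ℝ (B n (h (n + 1)) - c n + (P (h n) (h (n + 1)) - p (h n))) w = 0

namespace IsSubspaceDescent

variable {Φ : E → ℝ} {P : E → E →L[ℝ] E} {p : E → E} {B : ℕ → E →L[ℝ] E} {c : ℕ → E}
  {W : ℕ → Submodule ℝ E} {h : ℕ → E}

theorem descent (hΦ : IsQuadraticallyMajorized Φ P p) (hh : IsSubspaceDescent P p B c W h)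
    (n : ℕ) :
    quadratic (B n) (c n) (h (n + 1)) + Φ (h (n + 1))
      + 1 / 2 * inner ℝ (h (n + 1) - h n) (B n (h (n + 1) - h n))
      ≤ quadratic (B n) (c n) (h n) + Φ (h n) := by
  have horth := hh.orthogonal n _ ((W n).sub_mem (hh.mem_succ n) (hh.mem n))
  have hsplit : B n (h (n + 1)) - c n + (P (h n) (h (n + 1)) - p (h n))
      = (B n (h n) - c n) + (P (h n) (h n) - p (h n))
        + (B n (h (n + 1) - h n) + P (h n) (h (n + 1) - h n)) := by
    simp only [map_sub]; abel
  rw [hsplit, inner_add_left, inner_add_left, inner_add_left,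
    real_inner_comm (h (n + 1) - h n) (B n (h (n + 1) - h n)),
    real_inner_comm (h (n + 1) - h n) (P (h n) (h (n + 1) - h n))] at horth
  linarith [quadratic_expansion (hh.symm n) (c n) (h n) (h (n + 1)), hΦ.le (h n) (h (n + 1)),
    hΦ.nonneg (h n) (h (n + 1) - h n)]

theorem norm_gradient_le (hh : IsSubspaceDescent P p B c W h) (n : ℕ) :
    ‖B n (h n) - c n + (P (h n) (h n) - p (h n))‖
      ≤ (‖B n‖ + ‖P (h n)‖) * ‖h (n + 1) - h n‖ := by
  set g := B n (h n) - c n + (P (h n) (h n) - p (h n)) with hg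
  have hsplit : B n (h (n + 1)) - c n + (P (h n) (h (n + 1)) - p (h n))
      = g + (B n + P (h n)) (h (n + 1) - h n) := by
    simp only [hg, map_sub, add_apply]; abel
  have horth := hh.orthogonal n _ (hh.gradient_mem n)
  rw [hsplit, inner_add_left, ← hg, real_inner_self_eq_norm_sq] at horth
  have hcross : -inner ℝ ((B n + P (h n)) (h (n + 1) - h n)) g
      ≤ ((‖B n‖ + ‖P (h n)‖) * ‖h (n + 1) - h n‖) * ‖g‖ := by
    refine (neg_le_abs _).trans ((abs_real_inner_le_norm _ _).trans ?_)
    gcongr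
    exact (B n + P (h n)).le_of_opNorm_le (norm_add_le _ _) _
  rcases (norm_nonneg g).eq_or_lt with h0 | h0
  · rw [← h0]; positivity
  · exact le_of_mul_le_mul_right (by nlinarith) h0

variable {B' : E →L[ℝ] E} {c' : E} {α : ℝ} (hα : 0 < α) (hB : Tendsto B atTop (𝓝 B'))
  (hpos : ∀ x, α * ‖x‖ ^ 2 ≤ inner ℝ x (B' x)) (hc : Tendsto c atTop (𝓝 c'))

include hα hB hpos hc in
theorem isBounded_range (hΦ : IsQuadraticallyMajorized Φ P p)
    (hh : IsSubspaceDescent P p B c W h) : Bornology.IsBounded (range h) := by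
  obtain ⟨Cp, hCp⟩ := hΦ.bounded_vec
  obtain ⟨Cc, hCc⟩ := hc.norm.bddAbove_range
  have hev : ∀ᶠ n in atTop, ‖h (n + 1)‖ ≤ (Cc + Cp) / (α / 2) := by
    filter_upwards [eventually_coercive hα hB hpos] with n hn
    have horth := hh.orthogonal n _ (hh.mem_succ n)
    have hvec : inner ℝ (c n + p (h n)) (h (n + 1)) ≤ (Cc + Cp) * ‖h (n + 1)‖ := by
      refine (real_inner_le_norm _ _).trans ?_
      gcongr
      exact (norm_add_le _ _).trans (add_le_add (hCc (mem_range_self n)) (hCp _))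
    have hquad : α / 2 * ‖h (n + 1)‖ ^ 2 ≤ (Cc + Cp) * ‖h (n + 1)‖ := by
      simp only [inner_add_left, inner_sub_left] at horth hvec
      have hBn := hn (h (n + 1))
      have hPn := hΦ.nonneg (h n) (h (n + 1))
      rw [real_inner_comm] at hBn hPn
      linarith
    rw [le_div_iff₀ (half_pos hα)]
    rcases (norm_nonneg (h (n + 1))).eq_or_lt with h0 | h0
    · rw [← h0, zero_mul]
      exact add_nonneg ((norm_nonneg _).trans (hCc (mem_range_self 0)))
        ((norm_nonneg _).trans (hCp 0))
    · exact le_of_mul_le_mul_right (by nlinarith) h0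
  obtain ⟨K, hK⟩ := (isBoundedUnder_of_eventually_le hev).bddAbove_range
  refine isBounded_iff_forall_norm_le.2 ⟨max K ‖h 0‖, forall_mem_range.2 fun n => ?_⟩
  cases n with
  | zero => exact le_max_right _ _
  | succ n => exact (hK (mem_range_self n)).trans (le_max_left _ _)

include hα hB hpos hc in
theorem exists_eventually_le_cost [ProperSpace E] (hΦ : IsQuadraticallyMajorized Φ P p)
    (hb : Bornology.IsBounded (range h)) :
    ∃ K, ∀ᶠ n in atTop, K ≤ quadratic (B n) (c n) (h n) + Φ (h n) := by
  obtain ⟨K, hK⟩ := isBounded_iff_forall_norm_le.1 hb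
  obtain ⟨Cc, hCc⟩ := hc.norm.bddAbove_range
  obtain ⟨CΦ, hCΦ⟩ := (isCompact_closedBall (0 : E) K).exists_bound_of_continuousOn
    hΦ.continuous.continuousOn
  refine ⟨-(Cc * K + CΦ), ?_⟩
  filter_upwards [eventually_coercive hα hB hpos] with n hn
  have hquad : 0 ≤ inner ℝ (h n) (B n (h n)) := le_trans (by positivity) (hn (h n))
  have hlin : inner ℝ (c n) (h n) ≤ Cc * K := by
    refine (real_inner_le_norm _ _).trans ?_
    gcongr
    · exact (norm_nonneg _).trans (hCc (mem_range_self 0))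
    · exact hCc (mem_range_self n)
    · exact hK _ (mem_range_self n)
  have hΦn := neg_le_of_abs_le (hCΦ (h n) (by simpa using hK _ (mem_range_self n)))
  unfold quadratic
  linarith

variable (hinc : Tendsto (fun n => ‖h (n + 1) - h n‖) atTop (𝓝 0))

include hα hB hpos hc in
theorem tendsto_increments [ProperSpace E] (hΦ : IsQuadraticallyMajorized Φ P p)
    (hh : IsSubspaceDescent P p B c W h)
    (hsum : ∃ K, ∀ m, |∑ n ∈ Finset.range m,
      quadratic (B (n + 1) - B n) (c (n + 1) - c n) (h (n + 1))| ≤ K) :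
    Tendsto (fun n => ‖h (n + 1) - h n‖) atTop (𝓝 0) := by
  have hsummable : Summable fun n => α / 4 * ‖h (n + 1) - h n‖ ^ 2 := by
    refine summable_of_le_sub_succ_add (fun n => by positivity)
      (exists_eventually_le_cost hα hB hpos hc hΦ (hh.isBounded_range hα hB hpos hc hΦ)) hsum ?_
    filter_upwards [eventually_coercive hα hB hpos] with n hn
    rw [quadratic_sub]
    linarith [hh.descent hΦ n, hn (h (n + 1) - h n)]
  simpa [← mul_assoc, hα.ne'] using (hsummable.tendsto_atTop_zero.const_mul (4 / α)).sqrt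

include hB hc hinc in
theorem gradient_eq_zero_of_mem_clusterPoints (hP : Continuous P) (hp : Continuous p)
    (hh : IsSubspaceDescent P p B c W h) {z : E} (hz : z ∈ clusterPoints h) :
    B' z - c' + (P z z - p z) = 0 := by
  obtain ⟨U, hU, hUz⟩ := mapClusterPt_iff_ultrafilter.1 hz
  have hBU : Tendsto B U (𝓝 B') := hB.mono_left hU
  have hPU : Tendsto (fun n => P (h n)) U (𝓝 (P z)) := (hP.tendsto z).comp hUz
  have happ : Continuous fun q : (E →L[ℝ] E) × E => q.1 q.2 :=
    continuous_fst.clm_apply continuous_snd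
  have hlim : Tendsto (fun n => B n (h n) - c n + (P (h n) (h n) - p (h n))) U
      (𝓝 (B' z - c' + (P z z - p z))) :=
    (((happ.tendsto (B', z)).comp (hBU.prodMk_nhds hUz)).sub (hc.mono_left hU)).add
      (((happ.tendsto (P z, z)).comp (hPU.prodMk_nhds hUz)).sub ((hp.tendsto z).comp hUz))
  refine tendsto_nhds_unique hlim (squeeze_zero_norm (fun n => hh.norm_gradient_le n) ?_)
  simpa using (hBU.norm.add hPU.norm).mul (hinc.mono_left hU)

include hα hB hpos hc in
theorem clusterPoints_properties [ProperSpace E] (hΦ : IsQuadraticallyMajorized Φ P p)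
    (hh : IsSubspaceDescent P p B c W h)
    (hsum : ∃ K, ∀ m, |∑ n ∈ Finset.range m,
      quadratic (B (n + 1) - B n) (c (n + 1) - c n) (h (n + 1))| ≤ K) :
    Bornology.IsBounded (range h) ∧ IsPreconnected (clusterPoints h) ∧
      ∀ z ∈ clusterPoints h, B' z - c' + (P z z - p z) = 0 := by
  have hb := hh.isBounded_range hα hB hpos hc hΦ
  have hinc := hh.tendsto_increments hα hB hpos hc hΦ hsum
  exact ⟨hb, isPreconnected_clusterPoints hb (by simpa only [dist_eq_norm] using hinc),
    fun _ => hh.gradient_eq_zero_of_mem_clusterPoints hB hc hinc hΦ.continuous_op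
      hΦ.continuous_vec⟩

end IsSubspaceDescent

end Trajectory

/-- The mean of the terms `x 0, …, x n`. -/
noncomputable def sampleMean {E : Type*} [AddCommGroup E] [Module ℝ E] (x : ℕ → E) (n : ℕ) : E :=
  ((n : ℝ) + 1)⁻¹ • ∑ k ∈ Finset.range (n + 1), x k

theorem sampleMean_succ_sub {E : Type*} [AddCommGroup E] [Module ℝ E] (x : ℕ → E) (n : ℕ) :
    sampleMean x (n + 1) - sampleMean x n = ((n : ℝ) + 2)⁻¹ • (x (n + 1) - sampleMean x n) := by
  simp only [sampleMean, Finset.sum_range_succ _ (n + 1)]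
  push_cast
  match_scalars <;> field_simp <;> ring

theorem eq_zero_of_tendsto_of_summable_div {m : ℕ → ℝ} {l : ℝ} (hm : Tendsto m atTop (𝓝 l))
    (hs : Summable fun n : ℕ => |m n| / ((n : ℝ) + 2)) : l = 0 := by
  by_contra hne
  have hpos : 0 < |l| := abs_pos.2 hne
  suffices Summable fun n : ℕ => 1 / ((n : ℝ) + 2) from
    Real.not_summable_one_div_natCast ((summable_nat_add_iff 2).1 (by simpa using this))
  refine Summable.of_norm_bounded_eventually_nat (hs.mul_left (2 / |l|)) ?_
  filter_upwards [hm.abs.eventually (lt_mem_nhds (half_lt_self hpos))] with n hn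
  rw [Real.norm_of_nonneg (by positivity), ← mul_div_assoc]
  gcongr
  rw [div_mul_eq_mul_div, le_div_iff₀ hpos]
  linarith

section MartingaleDifference

variable {Ω : Type*} {m0 : MeasurableSpace Ω} {μ : Measure Ω}

theorem eLpNorm_one_eq_ofReal_integral_abs {f : Ω → ℝ} (hf : Integrable f μ) :
    eLpNorm f 1 μ = ENNReal.ofReal (∫ ω, |f ω| ∂μ) := by
  rw [eLpNorm_one_eq_lintegral_enorm, ← ofReal_integral_norm_eq_lintegral_enorm hf]
  rfl

theorem integral_abs_le_sqrt_integral_sq [IsProbabilityMeasure μ] {f : Ω → ℝ} (hf : MemLp f 2 μ) :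
    ∫ ω, |f ω| ∂μ ≤ √(∫ ω, f ω ^ 2 ∂μ) := by
  have hvar := ProbabilityTheory.variance_nonneg |f| μ
  rw [ProbabilityTheory.variance_eq_sub hf.abs, sub_nonneg] at hvar
  simp only [Pi.pow_apply, Pi.abs_apply, sq_abs] at hvar
  exact Real.le_sqrt_of_sq_le hvar

theorem ae_summable_of_summable_integral {f : ℕ → Ω → ℝ} (hf : ∀ n, Integrable (f n) μ)
    {a : ℕ → ℝ} (ha : Summable a) (hfa : ∀ n, ∫ ω, |f n ω| ∂μ ≤ a n) :
    ∀ᵐ ω ∂μ, Summable fun n => |f n ω| := by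
  have hfin : ∑' n, eLpNorm (f n) 1 μ ≠ ⊤ := by
    refine ne_top_of_le_ne_top ha.tsum_ofReal_ne_top (ENNReal.tsum_le_tsum fun n => ?_)
    rw [eLpNorm_one_eq_ofReal_integral_abs (hf n)]
    exact ENNReal.ofReal_le_ofReal (hfa n)
  filter_upwards [summable_norm_of_tsum_eLpNorm_ne_top le_rfl
    (fun n => (hf n).aestronglyMeasurable) hfin] with ω hω
  exact hω

/-- `ξ` is bounded in `L²` with second moments at most `C`, and its terms of positive index are
martingale differences; `ξ 0` need not be centred. -/
structure IsMartingaleDifference (ℱ : Filtration ℕ m0) (μ : Measure Ω) (ξ : ℕ → Ω → ℝ) (C : ℝ) :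
    Prop where
  adapted : StronglyAdapted ℱ ξ
  memLp : ∀ n, MemLp (ξ n) 2 μ
  sq_le : ∀ n, ∫ ω, ξ n ω ^ 2 ∂μ ≤ C
  condExp : ∀ n, μ[ξ (n + 1) | ℱ n] =ᵐ[μ] 0

/-- The martingale transform of the differences `ξ` by the weights `w`, started at `ξ 0`; the
weight `w n` multiplies `ξ (n + 1)`, so that adapted weights are non-anticipative. -/
def martingaleTransform (w ξ : ℕ → Ω → ℝ) (m : ℕ) (ω : Ω) : ℝ :=
  ξ 0 ω + ∑ n ∈ Finset.range m, w n ω * ξ (n + 1) ω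

theorem martingaleTransform_zero (w ξ : ℕ → Ω → ℝ) : martingaleTransform w ξ 0 = ξ 0 := by
  ext ω
  simp only [martingaleTransform, Finset.range_zero, Finset.sum_empty, add_zero]

theorem martingaleTransform_succ (w ξ : ℕ → Ω → ℝ) (m : ℕ) :
    martingaleTransform w ξ (m + 1) = martingaleTransform w ξ m + w m * ξ (m + 1) := by
  ext ω
  simp only [martingaleTransform, Finset.sum_range_succ, Pi.add_apply, Pi.mul_apply, add_assoc]

theorem martingaleTransform_one (ξ : ℕ → Ω → ℝ) (m : ℕ) (ω : Ω) :
    martingaleTransform 1 ξ m ω = ∑ k ∈ Finset.range (m + 1), ξ k ω := by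
  simp only [martingaleTransform, Finset.sum_range_succ' _ m, Pi.one_apply, one_mul, add_comm]

theorem memLp_mul_of_abs_le {w f : Ω → ℝ} {K : ℝ} (hw : AEStronglyMeasurable w μ)
    (hK : ∀ ω, |w ω| ≤ K) (hf : MemLp f 2 μ) : MemLp (w * f) 2 μ :=
  hf.of_le_mul (c := K) (hw.mul hf.1) (Eventually.of_forall fun ω => by
    rw [Pi.mul_apply, norm_mul]; exact mul_le_mul_of_nonneg_right (hK ω) (norm_nonneg _))

namespace IsMartingaleDifference

variable {ℱ : Filtration ℕ m0} {ξ w : ℕ → Ω → ℝ} {C : ℝ}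
  (hξ : IsMartingaleDifference ℱ μ ξ C)
include hξ

theorem const_nonneg : 0 ≤ C :=
  (integral_nonneg fun ω => sq_nonneg (ξ 0 ω)).trans (hξ.sq_le 0)

section Transform

variable {k : ℕ → ℝ} (hw : StronglyAdapted ℱ w)
include hw

theorem stronglyAdapted_transform : StronglyAdapted ℱ (martingaleTransform w ξ) := fun m =>
  ((hξ.adapted 0).mono (ℱ.mono m.zero_le)).add <|
    Finset.stronglyMeasurable_fun_sum _ fun n hn =>
      ((hw n).mono (ℱ.mono (Finset.mem_range.1 hn).le)).mul
        ((hξ.adapted (n + 1)).mono (ℱ.mono (Finset.mem_range.1 hn)))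

variable (hk : ∀ n ω, |w n ω| ≤ k n)
include hk

theorem memLp_mul (n : ℕ) : MemLp (w n * ξ (n + 1)) 2 μ :=
  memLp_mul_of_abs_le ((hw n).mono (ℱ.le n)).aestronglyMeasurable (hk n) (hξ.memLp (n + 1))

theorem memLp_transform (m : ℕ) : MemLp (martingaleTransform w ξ m) 2 μ := by
  induction m with
  | zero => simpa only [martingaleTransform_zero] using hξ.memLp 0
  | succ m ih =>
    rw [martingaleTransform_succ]
    exact ih.add (hξ.memLp_mul hw hk m)

variable [IsProbabilityMeasure μ]

theorem condExp_mul (n : ℕ) : μ[w n * ξ (n + 1) | ℱ n] =ᵐ[μ] 0 := by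
  filter_upwards [condExp_mul_of_stronglyMeasurable_left (hw n)
    ((hξ.memLp_mul hw hk n).integrable one_le_two)
    ((hξ.memLp (n + 1)).integrable one_le_two), hξ.condExp n] with ω hmul hzero
  simp [hmul, hzero]

theorem martingale_transform : Martingale (martingaleTransform w ξ) ℱ μ := by
  refine martingale_of_condExp_sub_eq_zero_nat (hξ.stronglyAdapted_transform hw)
    (fun m => (hξ.memLp_transform hw hk m).integrable one_le_two) fun m => ?_
  rw [martingaleTransform_succ, add_sub_cancel_left]
  exact hξ.condExp_mul hw hk m

theorem integral_transform_mul_eq_zero (m : ℕ) :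
    ∫ ω, martingaleTransform w ξ m ω * (w m * ξ (m + 1)) ω ∂μ = 0 := by
  have hint : Integrable (martingaleTransform w ξ m * (w m * ξ (m + 1))) μ :=
    (hξ.memLp_transform hw hk m).integrable_mul (hξ.memLp_mul hw hk m)
  have hcond : μ[martingaleTransform w ξ m * (w m * ξ (m + 1)) | ℱ m] =ᵐ[μ] 0 := by
    filter_upwards [condExp_mul_of_stronglyMeasurable_left (hξ.stronglyAdapted_transform hw m) hint
      ((hξ.memLp_mul hw hk m).integrable one_le_two), hξ.condExp_mul hw hk m] with ω hmul hzero
    simp [hmul, hzero]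
  calc ∫ ω, (martingaleTransform w ξ m * (w m * ξ (m + 1))) ω ∂μ
      = ∫ ω, μ[martingaleTransform w ξ m * (w m * ξ (m + 1)) | ℱ m] ω ∂μ :=
        (integral_condExp (ℱ.le m)).symm
    _ = 0 := by rw [integral_congr_ae hcond]; simp

omit [IsProbabilityMeasure μ] in
theorem integral_mul_sq_le (n : ℕ) : ∫ ω, (w n * ξ (n + 1)) ω ^ 2 ∂μ ≤ k n ^ 2 * C :=
  calc ∫ ω, (w n * ξ (n + 1)) ω ^ 2 ∂μ ≤ ∫ ω, k n ^ 2 * ξ (n + 1) ω ^ 2 ∂μ := by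
        refine integral_mono (hξ.memLp_mul hw hk n).integrable_sq
          ((hξ.memLp (n + 1)).integrable_sq.const_mul _) fun ω => ?_
        simp only [Pi.mul_apply, mul_pow]
        gcongr ?_ * _
        rw [← sq_abs]
        exact pow_le_pow_left₀ (abs_nonneg _) (hk n ω) 2
    _ ≤ k n ^ 2 * C := by
        rw [integral_const_mul]
        gcongr
        exact hξ.sq_le _

theorem integral_transform_sq_le (m : ℕ) :
    ∫ ω, martingaleTransform w ξ m ω ^ 2 ∂μ ≤ (1 + ∑ n ∈ Finset.range m, k n ^ 2) * C := by
  induction m with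
  | zero => simpa [martingaleTransform_zero] using hξ.sq_le 0
  | succ m ih =>
    have hT := hξ.memLp_transform hw hk m
    have hinc := hξ.memLp_mul hw hk m
    have hcross : Integrable (fun ω => martingaleTransform w ξ m ω * (w m * ξ (m + 1)) ω) μ :=
      hT.integrable_mul hinc
    have hexpand : ∀ ω, martingaleTransform w ξ (m + 1) ω ^ 2 = martingaleTransform w ξ m ω ^ 2
        + 2 * (martingaleTransform w ξ m ω * (w m * ξ (m + 1)) ω) + (w m * ξ (m + 1)) ω ^ 2 :=
      fun ω => by rw [martingaleTransform_succ, Pi.add_apply]; ring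
    have hsplit : Integrable (fun ω => martingaleTransform w ξ m ω ^ 2
        + 2 * (martingaleTransform w ξ m ω * (w m * ξ (m + 1)) ω)) μ :=
      hT.integrable_sq.add (hcross.const_mul 2)
    simp only [hexpand]
    rw [integral_add hsplit hinc.integrable_sq,
      integral_add hT.integrable_sq (hcross.const_mul 2), integral_const_mul,
      hξ.integral_transform_mul_eq_zero hw hk m, Finset.sum_range_succ]
    linarith [hξ.integral_mul_sq_le hw hk m]

theorem ae_exists_tendsto_transform (hsum : Summable fun n => k n ^ 2) :
    ∀ᵐ ω ∂μ, ∃ l, Tendsto (martingaleTransform w ξ · ω) atTop (𝓝 l) := by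
  have hC := hξ.const_nonneg
  refine (hξ.martingale_transform hw hk).submartingale.exists_ae_tendsto_of_bdd
    (R := (√((1 + ∑' n, k n ^ 2) * C)).toNNReal) fun m => ?_
  have hT := hξ.memLp_transform hw hk m
  rw [eLpNorm_one_eq_ofReal_integral_abs (hT.integrable one_le_two)]
  refine ENNReal.ofReal_le_ofReal ((integral_abs_le_sqrt_integral_sq hT).trans ?_)
  refine Real.sqrt_le_sqrt ((hξ.integral_transform_sq_le hw hk m).trans ?_)
  gcongr
  exact hsum.sum_le_tsum _ fun n _ => sq_nonneg _

end Transform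

variable [IsProbabilityMeasure μ] {a : ℕ → Ω → ℝ} (ha : StronglyAdapted ℱ a)

include ha in
theorem ae_exists_tendsto_sum_mul_div_of_bounded {K : ℝ} (hK : ∀ n ω, |a n ω| ≤ K) :
    ∀ᵐ ω ∂μ, ∃ l, Tendsto
      (fun m => ∑ n ∈ Finset.range m, a n ω * (ξ (n + 1) ω / ((n : ℝ) + 2))) atTop (𝓝 l) := by
  have hsum : Summable fun n : ℕ => (K / ((n : ℝ) + 2)) ^ 2 := by
    have hsq : Summable fun n : ℕ => (((n + 2 : ℕ) : ℝ) ^ 2)⁻¹ :=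
      (summable_nat_add_iff 2).2 (Real.summable_nat_pow_inv.2 one_lt_two)
    exact (hsq.mul_left (K ^ 2)).congr fun n => by push_cast; rw [div_pow, div_eq_mul_inv]
  have hbound : ∀ (n : ℕ) ω, |a n ω / ((n : ℝ) + 2)| ≤ K / ((n : ℝ) + 2) := fun n ω => by
    rw [abs_div, abs_of_nonneg (by positivity : (0 : ℝ) ≤ n + 2)]
    exact div_le_div_of_nonneg_right (hK n ω) (by positivity)
  have hadapt : StronglyAdapted ℱ fun n ω => a n ω / ((n : ℝ) + 2) := fun n => by
    simpa only [div_eq_mul_inv] using (ha n).mul_const _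
  filter_upwards [hξ.ae_exists_tendsto_transform hadapt hbound hsum] with ω ⟨l, hl⟩
  refine ⟨l - ξ 0 ω, (hl.sub_const _).congr fun m => ?_⟩
  rw [martingaleTransform, add_sub_cancel_left]
  exact Finset.sum_congr rfl fun n _ => by ring

include ha in
theorem ae_exists_tendsto_sum_mul_div (hK : ∀ᵐ ω ∂μ, ∃ K, ∀ n, |a n ω| ≤ K) :
    ∀ᵐ ω ∂μ, ∃ l, Tendsto
      (fun m => ∑ n ∈ Finset.range m, a n ω * (ξ (n + 1) ω / ((n : ℝ) + 2))) atTop (𝓝 l) := by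
  have htrunc : ∀ᵐ ω ∂μ, ∀ K : ℕ, ∃ l, Tendsto (fun m => ∑ n ∈ Finset.range m,
      max (-(K : ℝ)) (min (a n ω) K) * (ξ (n + 1) ω / ((n : ℝ) + 2))) atTop (𝓝 l) := by
    rw [ae_all_iff]
    intro K
    have hclip : Continuous fun x : ℝ => max (-(K : ℝ)) (min x K) := by fun_prop
    refine hξ.ae_exists_tendsto_sum_mul_div_of_bounded (K := K)
      (fun n => hclip.comp_stronglyMeasurable (ha n)) fun n ω => ?_
    exact abs_le.2 ⟨le_max_left _ _, max_le (neg_le_self K.cast_nonneg) (min_le_right _ _)⟩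
  filter_upwards [htrunc, hK] with ω hω ⟨K, hK⟩
  obtain ⟨k, hk⟩ := exists_nat_ge K
  obtain ⟨l, hl⟩ := hω k
  refine ⟨l, hl.congr fun m => Finset.sum_congr rfl fun n _ => ?_⟩
  have hak := abs_le.1 ((hK n).trans hk)
  rw [min_eq_left hak.2, max_eq_right hak.1]

omit [IsProbabilityMeasure μ] in
theorem memLp_sampleMean (n : ℕ) : MemLp (fun ω => sampleMean (ξ · ω) n) 2 μ :=
  (memLp_finsetSum _ fun k _ => hξ.memLp k).const_mul _

theorem integral_abs_sampleMean_le (n : ℕ) :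
    ∫ ω, |sampleMean (ξ · ω) n| ∂μ ≤ ((n : ℝ) + 1)⁻¹ * √(((n : ℝ) + 1) * C) := by
  have hone : StronglyAdapted ℱ (1 : ℕ → Ω → ℝ) := fun _ => stronglyMeasurable_const
  have hbound : ∀ (n : ℕ) ω, |(1 : ℕ → Ω → ℝ) n ω| ≤ 1 := by simp
  have hmean : ∀ ω, |sampleMean (ξ · ω) n| = ((n : ℝ) + 1)⁻¹ * |martingaleTransform 1 ξ n ω| :=
    fun ω => by
      rw [martingaleTransform_one, sampleMean, smul_eq_mul, abs_mul, abs_of_pos (by positivity)]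
  simp only [hmean]
  rw [integral_const_mul]
  gcongr
  refine (integral_abs_le_sqrt_integral_sq (hξ.memLp_transform hone hbound n)).trans ?_
  refine Real.sqrt_le_sqrt ((hξ.integral_transform_sq_le hone hbound n).trans_eq ?_)
  simp [add_comm]

theorem ae_summable_sampleMean_div :
    ∀ᵐ ω ∂μ, Summable fun n : ℕ => |sampleMean (ξ · ω) n| / ((n : ℝ) + 2) := by
  have hsum : Summable fun n : ℕ => ((n : ℝ) + 1) ^ (-(3 / 2) : ℝ) * √C := by
    have := (summable_nat_add_iff 1).2
      (Real.summable_nat_rpow.2 (by norm_num : (-(3 / 2) : ℝ) < -1))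
    exact (by simpa using this : Summable _).mul_right _
  have habs : ∀ (n : ℕ) ω, |sampleMean (ξ · ω) n / ((n : ℝ) + 2)|
      = |sampleMean (ξ · ω) n| / ((n : ℝ) + 2) := fun n ω => by
    rw [abs_div, abs_of_nonneg (by positivity : (0 : ℝ) ≤ n + 2)]
  have key := ae_summable_of_summable_integral
    (fun n => ((hξ.memLp_sampleMean n).integrable one_le_two).div_const ((n : ℝ) + 2)) hsum
    fun n => ?_
  · simpa only [habs] using key
  have hr : (0 : ℝ) < n + 1 := by positivity
  simp only [habs]
  calc ∫ ω, |sampleMean (ξ · ω) n| / ((n : ℝ) + 2) ∂μ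
      ≤ ((n : ℝ) + 1)⁻¹ * √(((n : ℝ) + 1) * C) / ((n : ℝ) + 1) := by
        rw [integral_div]
        gcongr
        · exact hξ.integral_abs_sampleMean_le n
        · norm_num
    _ = ((n : ℝ) + 1) ^ (-(3 / 2) : ℝ) * √C := by
        rw [Real.sqrt_mul hr.le, Real.sqrt_eq_rpow, show (-(3 / 2) : ℝ) = 1 / 2 - 2 by norm_num,
          Real.rpow_sub hr, Real.rpow_two]
        field_simp

-- `m (n + 1) - m n = (ξ (n + 1) - m n) / (n + 2)` for the means `m`: the first part is a
-- martingale transform, the second one is absolutely summable.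
include ha in
theorem ae_exists_tendsto_sum_mul_increments (hK : ∀ᵐ ω ∂μ, ∃ K, ∀ n, |a n ω| ≤ K) :
    ∀ᵐ ω ∂μ, ∃ l, Tendsto (fun m => ∑ n ∈ Finset.range m, a n ω *
      (sampleMean (ξ · ω) (n + 1) - sampleMean (ξ · ω) n)) atTop (𝓝 l) := by
  filter_upwards [hξ.ae_exists_tendsto_sum_mul_div ha hK, hξ.ae_summable_sampleMean_div, hK]
    with ω ⟨l, hl⟩ hs ⟨K, hK⟩
  have hmean : Summable fun n : ℕ => a n ω * (sampleMean (ξ · ω) n / ((n : ℝ) + 2)) := by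
    refine Summable.of_norm_bounded (hs.mul_left K) fun n => ?_
    rw [norm_mul, Real.norm_eq_abs, norm_div, Real.norm_eq_abs,
      Real.norm_of_nonneg (by positivity : (0 : ℝ) ≤ n + 2)]
    exact mul_le_mul_of_nonneg_right (hK n) (by positivity)
  refine ⟨_, (hl.sub hmean.hasSum.tendsto_sum_nat).congr fun m => ?_⟩
  rw [← Finset.sum_sub_distrib]
  refine Finset.sum_congr rfl fun n _ => ?_
  rw [sampleMean_succ_sub, smul_eq_mul]
  ring

theorem ae_tendsto_sampleMean :
    ∀ᵐ ω ∂μ, Tendsto (sampleMean (ξ · ω)) atTop (𝓝 0) := by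
  have hone : StronglyAdapted ℱ (1 : ℕ → Ω → ℝ) := fun _ => stronglyMeasurable_const
  filter_upwards [hξ.ae_exists_tendsto_sum_mul_increments hone
    (Eventually.of_forall fun ω => ⟨1, by simp⟩), hξ.ae_summable_sampleMean_div] with ω ⟨l, hl⟩ hs
  have hlim : Tendsto (sampleMean (ξ · ω)) atTop (𝓝 (l + sampleMean (ξ · ω) 0)) :=
    (hl.add_const _).congr fun n => by
      simp only [Pi.one_apply, one_mul, Finset.sum_range_sub, sub_add_cancel]
  rwa [eq_zero_of_tendsto_of_summable_div hlim hs] at hlim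

end IsMartingaleDifference

end MartingaleDifference

section PositiveOperator

variable {E F : Type*} [NormedAddCommGroup E] [InnerProductSpace ℝ E] [NormedAddCommGroup F]
  [InnerProductSpace ℝ F] {A : E →L[ℝ] E}

theorem norm_apply_sq_le_of_isPositive (hA : A.IsPositive) (x : E) :
    ‖A x‖ ^ 2 ≤ ‖A‖ * inner ℝ x (A x) := by
  rcases (norm_nonneg A).eq_or_lt with h0 | h0
  · simp [norm_eq_zero.1 h0.symm]
  have hquad := hA.inner_nonneg_right (‖A‖ • x - A x)
  simp only [map_sub, map_smul, inner_sub_left, inner_sub_right, inner_smul_left,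
    inner_smul_right, conj_trivial, ← hA.inner_left_eq_inner_right x (A x),
    real_inner_self_eq_norm_sq] at hquad
  have hAA : inner ℝ (A x) (A (A x)) ≤ ‖A‖ * ‖A x‖ ^ 2 := by
    refine (real_inner_le_norm _ _).trans ?_
    rw [sq, mul_left_comm]
    exact mul_le_mul_of_nonneg_left (A.le_opNorm _) (norm_nonneg _)
  exact le_of_mul_le_mul_left (by linarith) h0

theorem exists_coercive_of_isPositive [FiniteDimensional ℝ E] (hA : A.IsPositive)
    {W : Submodule ℝ E} (hW : ∀ w ∈ W, A w = 0 → w = 0) :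
    ∃ α > 0, ∀ w ∈ W, α * ‖w‖ ^ 2 ≤ inner ℝ w (A w) := by
  have hker : ((A : E →ₗ[ℝ] E).domRestrict W).ker = ⊥ :=
    LinearMap.ker_eq_bot'.2 fun w hw => Subtype.ext (hW w.1 w.2 hw)
  obtain ⟨κ, hκ0, hκ⟩ := LinearMap.exists_antilipschitzWith _ hker
  have hpos : (0 : ℝ) < κ ^ 2 * (‖A‖ + 1) := by positivity
  refine ⟨(κ ^ 2 * (‖A‖ + 1))⁻¹, inv_pos.2 hpos, fun w hw => ?_⟩
  rw [inv_mul_le_iff₀ hpos]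
  have hlip : ‖w‖ ≤ κ * ‖A w‖ := by simpa using hκ.le_mul_dist ⟨w, hw⟩ 0
  calc ‖w‖ ^ 2 ≤ (κ * ‖A w‖) ^ 2 := by gcongr
    _ = κ ^ 2 * ‖A w‖ ^ 2 := mul_pow _ _ _
    _ ≤ κ ^ 2 * ((‖A‖ + 1) * inner ℝ w (A w)) := by
        gcongr
        exact (norm_apply_sq_le_of_isPositive hA w).trans
          (mul_le_mul_of_nonneg_right (by linarith) (hA.inner_nonneg_right w))
    _ = κ ^ 2 * (‖A‖ + 1) * inner ℝ w (A w) := (mul_assoc _ _ _).symm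

theorem mul_norm_sub_sq_le_of_tikhonov {D : F →L[ℝ] E} {c : E} {α ε : ℝ} {u u' : F}
    (hα : ∀ w, α * ‖D w‖ ^ 2 ≤ inner ℝ (D w) (A (D w))) (hε : 0 ≤ ε)
    (hu : ∀ w, inner ℝ (A (D u) - c) (D w) = 0)
    (hu' : ∀ w, inner ℝ (A (D u') - c) (D w) + ε * inner ℝ u' w = 0) :
    α * ‖D u' - D u‖ ^ 2 ≤ ε * ‖u‖ ^ 2 := by
  have hdiff : inner ℝ (D (u' - u)) (A (D (u' - u))) = -(ε * inner ℝ u' (u' - u)) := by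
    rw [real_inner_comm]
    have h := hu (u' - u)
    have h' := hu' (u' - u)
    simp only [map_sub, inner_sub_left] at h h' ⊢
    linarith
  have hcauchy : -inner ℝ u' (u' - u) ≤ ‖u‖ ^ 2 := by
    rw [inner_sub_right, real_inner_self_eq_norm_sq]
    nlinarith [real_inner_le_norm u' u, sq_nonneg (‖u'‖ - ‖u‖), sq_nonneg ‖u'‖]
  rw [← map_sub]
  nlinarith [hα (u' - u)]

end PositiveOperator

section Matrices

variable {l m n : ℕ}

/-- The continuous linear map `x ↦ A x` between Euclidean spaces, linearly in the matrix `A`. -/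
noncomputable def toCLM : Matrix (Fin m) (Fin n) ℝ →ₗ[ℝ] (Vec n →L[ℝ] Vec m) :=
  LinearMap.toContinuousLinearMap.toLinearMap ∘ₗ Matrix.toEuclideanLin.toLinearMap

theorem toCLM_apply_eq (A : Matrix (Fin m) (Fin n) ℝ) (x : Vec n) :
    toCLM A x = WithLp.toLp 2 (A *ᵥ x.ofLp) := rfl

theorem continuous_toCLM : Continuous (toCLM (m := m) (n := n)) :=
  toCLM.continuous_of_finiteDimensional

theorem toCLM_mul_apply (A : Matrix (Fin l) (Fin m) ℝ) (B : Matrix (Fin m) (Fin n) ℝ) (x : Vec n) :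
    toCLM (A * B) x = toCLM A (toCLM B x) := by
  simp only [toCLM_apply_eq, Matrix.mulVec_mulVec]

theorem toCLM_one_apply (x : Vec n) : toCLM (1 : Matrix (Fin n) (Fin n) ℝ) x = x := by
  simp only [toCLM_apply_eq, Matrix.one_mulVec]

theorem adjoint_toCLM (A : Matrix (Fin m) (Fin n) ℝ) : (toCLM A).adjoint = toCLM Aᵀ := by
  ext1 x
  refine ext_inner_right ℝ fun z => ?_
  rw [ContinuousLinearMap.adjoint_inner_left, ← A.conjTranspose_eq_transpose_of_trivial]
  change inner ℝ x (A.toEuclideanLin z) = inner ℝ (Aᴴ.toEuclideanLin x) z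
  rw [Matrix.toEuclideanLin_conjTranspose_eq_adjoint, LinearMap.adjoint_inner_left]

theorem inner_toCLM_transpose (A : Matrix (Fin m) (Fin n) ℝ) (x : Vec m) (z : Vec n) :
    inner ℝ (toCLM Aᵀ x) z = inner ℝ x (toCLM A z) := by
  rw [← adjoint_toCLM, ContinuousLinearMap.adjoint_inner_left]

theorem isPositive_toCLM {A : Matrix (Fin n) (Fin n) ℝ} (hA : A.PosSemidef) :
    (toCLM A).IsPositive :=
  (LinearMap.isPositive_toContinuousLinearMap_iff _).2 (Matrix.isPositive_toEuclideanLin_iff.2 hA)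

theorem toCLM_inv_apply {A : Matrix (Fin n) (Fin n) ℝ} (hA : IsUnit A) (x : Vec n) :
    toCLM A (toCLM A⁻¹ x) = x := by
  rw [← toCLM_mul_apply, Matrix.mul_nonsing_inv _ ((Matrix.isUnit_iff_isUnit_det _).1 hA),
    toCLM_one_apply]

theorem exists_coercive_of_posDef {A : Matrix (Fin n) (Fin n) ℝ} (hA : A.PosDef) :
    ∃ α > 0, ∀ x, α * ‖x‖ ^ 2 ≤ inner ℝ x (toCLM A x) := by
  have hinj : ∀ x ∈ (⊤ : Submodule ℝ (Vec n)), toCLM A x = 0 → x = 0 := fun x _ hx => by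
    refine (WithLp.ofLp_injective 2).eq_iff.1 ?_
    exact Matrix.mulVec_injective_of_isUnit hA.isUnit (by simpa [toCLM_apply_eq] using hx)
  obtain ⟨α, hα, h⟩ := exists_coercive_of_isPositive (isPositive_toCLM hA.posSemidef) hinj
  exact ⟨α, hα, fun x => h x trivial⟩

end Matrices

section MinimizerMeasurability

variable {m n : ℕ}

instance instBorelSpaceMatrix : BorelSpace (Matrix (Fin m) (Fin n) ℝ) :=
  inferInstanceAs (BorelSpace (Fin m → Fin n → ℝ))

instance instSecondCountableTopologyMatrix :
    SecondCountableTopology (Matrix (Fin m) (Fin n) ℝ) :=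
  inferInstanceAs (SecondCountableTopology (Fin m → Fin n → ℝ))

/-- The data `(A, D, c)` of the minimization of `quadratic A c` over `ran D`. -/
abbrev QuadraticData (n m : ℕ) :=
  Matrix (Fin n) (Fin n) ℝ × Matrix (Fin n) (Fin m) ℝ × Vec n

namespace QuadraticData

/-- The matrix `Dᵀ A D + ε I` of the Tikhonov regularization. -/
def regularizedMatrix (ε : ℝ) (q : QuadraticData n m) : Matrix (Fin m) (Fin m) ℝ :=
  (q.2.1)ᵀ * q.1 * q.2.1 + ε • 1

/-- The coordinates with respect to `D` of the Tikhonov regularized minimizer over `ran D`. -/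
noncomputable def regularizedCoord (ε : ℝ) (q : QuadraticData n m) : Vec m :=
  toCLM (q.regularizedMatrix ε)⁻¹ (toCLM (q.2.1)ᵀ q.2.2)

/-- The limit of the regularized minimizers, which depends measurably on the data; it is the
minimizer when the data are coercive, and a junk value if there is no limit. -/
noncomputable def limitSolution (q : QuadraticData n m) : Vec n :=
  limUnder atTop fun k : ℕ => toCLM q.2.1 (q.regularizedCoord (1 / ((k : ℝ) + 1)))

/-- The data for which the quadratic form of `A` is coercive on `ran D`. -/
def coerciveSet (n m : ℕ) : Set (QuadraticData n m) :=
  {q | ∃ α > 0, ∀ w ∈ ran q.2.1, α * ‖w‖ ^ 2 ≤ inner ℝ w (toCLM q.1 w)}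

theorem measurable_regularizedCoord (ε : ℝ) :
    Measurable (regularizedCoord ε : QuadraticData n m → Vec m) := by
  have hmatrix : Continuous (regularizedMatrix ε : QuadraticData n m → _) := by
    unfold regularizedMatrix
    fun_prop
  have hcramer : (regularizedCoord ε : QuadraticData n m → Vec m) = fun q =>
      (q.regularizedMatrix ε).det⁻¹ •
        toCLM (q.regularizedMatrix ε).adjugate (toCLM (q.2.1)ᵀ q.2.2) := by
    ext1 q
    rw [regularizedCoord, Matrix.inv_def, Ring.inverse_eq_inv', map_smul, smul_apply]
  rw [hcramer]
  refine hmatrix.matrix_det.measurable.inv.smul (Continuous.measurable ?_)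
  exact (continuous_toCLM.comp hmatrix.matrix_adjugate).clm_apply
    ((continuous_toCLM.comp (by fun_prop)).clm_apply (by fun_prop))

theorem measurable_limitSolution : Measurable (limitSolution : QuadraticData n m → Vec n) := by
  refine (StronglyMeasurable.limUnder fun k : ℕ => Measurable.stronglyMeasurable ?_).measurable
  have happly : Continuous fun p : (Vec m →L[ℝ] Vec n) × Vec m => p.1 p.2 := by fun_prop
  exact happly.measurable.comp
    ((continuous_toCLM.measurable.comp (by fun_prop)).prodMk (measurable_regularizedCoord _))

theorem measurableSet_coerciveSet : MeasurableSet (coerciveSet n m) := by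
  have hunion : coerciveSet n m = ⋃ k : ℕ, ⋂ u : Vec m, {q | 1 / ((k : ℝ) + 1) *
      ‖toCLM q.2.1 u‖ ^ 2 ≤ inner ℝ (toCLM q.2.1 u) (toCLM q.1 (toCLM q.2.1 u))} := by
    ext q
    simp only [mem_iUnion, mem_iInter, mem_ofPred_eq]
    constructor
    · rintro ⟨α, hα, h⟩
      obtain ⟨k, hk⟩ := exists_nat_one_div_lt hα
      exact ⟨k, fun u => le_trans (by gcongr) (h _ ⟨u, rfl⟩)⟩
    · rintro ⟨k, hk⟩
      exact ⟨1 / ((k : ℝ) + 1), by positivity, by rintro _ ⟨u, rfl⟩; exact hk u⟩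
  rw [hunion]
  refine MeasurableSet.iUnion fun k => (isClosed_iInter fun u => ?_).measurableSet
  have hA : Continuous fun q : QuadraticData n m => toCLM q.1 :=
    continuous_toCLM.comp continuous_fst
  have hD : Continuous fun q : QuadraticData n m => toCLM q.2.1 u :=
    (continuous_toCLM.comp continuous_snd.fst).clm_apply continuous_const
  exact isClosed_le (by fun_prop) (hD.inner (hA.clm_apply hD))

theorem inner_regularizedCoord {q : QuadraticData n m} (hA : q.1.PosSemidef) {ε : ℝ} (hε : 0 < ε)
    (w : Vec m) :
    inner ℝ (toCLM q.1 (toCLM q.2.1 (q.regularizedCoord ε)) - q.2.2) (toCLM q.2.1 w)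
      + ε * inner ℝ (q.regularizedCoord ε) w = 0 := by
  have hpos : (q.regularizedMatrix ε).PosDef := by
    refine Matrix.PosDef.posSemidef_add ?_ (Matrix.PosDef.one.smul hε)
    simpa using hA.conjTranspose_mul_mul_same q.2.1
  have hsol : toCLM (q.regularizedMatrix ε) (q.regularizedCoord ε) = toCLM (q.2.1)ᵀ q.2.2 :=
    toCLM_inv_apply hpos.isUnit _
  rw [← inner_toCLM_transpose, map_sub, ← hsol, ← real_inner_smul_left, ← inner_add_left,
    regularizedMatrix, map_add, map_smul, add_apply, smul_apply, toCLM_one_apply,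
    toCLM_mul_apply, toCLM_mul_apply]
  simp

theorem limitSolution_eq {q : QuadraticData n m} (hA : q.1.PosSemidef) (hq : q ∈ coerciveSet n m)
    {z : Vec n} (hz : z ∈ ran q.2.1)
    (horth : ∀ w ∈ ran q.2.1, inner ℝ (toCLM q.1 z - q.2.2) w = 0) :
    q.limitSolution = z := by
  obtain ⟨α, hα, hcoercive⟩ := hq
  obtain ⟨u, hu : toCLM q.2.1 u = z⟩ := hz
  subst hu
  refine Tendsto.limUnder_eq (tendsto_iff_norm_sub_tendsto_zero.2 ?_)
  have hbound : ∀ k : ℕ, ‖toCLM q.2.1 (q.regularizedCoord (1 / ((k : ℝ) + 1))) - toCLM q.2.1 u‖ ^ 2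
      ≤ 1 / ((k : ℝ) + 1) * (‖u‖ ^ 2 / α) := fun k => by
    have hε : (0 : ℝ) < 1 / ((k : ℝ) + 1) := by positivity
    rw [← mul_div_assoc, le_div_iff₀' hα]
    exact mul_norm_sub_sq_le_of_tikhonov (fun w => hcoercive _ ⟨w, rfl⟩) hε.le
      (fun w => horth _ ⟨w, rfl⟩) (inner_regularizedCoord hA hε)
  have hzero : Tendsto (fun k : ℕ => 1 / ((k : ℝ) + 1) * (‖u‖ ^ 2 / α)) atTop (𝓝 0) := by
    simpa using (tendsto_one_div_add_atTop_nhds_zero_nat (𝕜 := ℝ)).mul_const (‖u‖ ^ 2 / α)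
  simpa using (squeeze_zero (fun k => sq_nonneg _) hbound hzero).sqrt

end QuadraticData

end MinimizerMeasurability

namespace Regularizer

variable {N : ℕ} {reg : Regularizer N}

/-- The matrix `Vₛ` of the regularizer as a continuous linear map. -/
noncomputable abbrev L (reg : Regularizer N) (s : Fin reg.S) : Vec N →L[ℝ] Vec (reg.P s) :=
  toCLM (reg.V s)

theorem Assumption1.isPotential (h₁ : reg.Assumption1) (s : Fin reg.S) :
    IsPotential (reg.ψ s) where
  contDiff := h₁.contDiff s
  limit_zero := h₁.limit_zero s
  concave_sqrt := h₁.concave_sqrt s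
  weight_nonneg t ht := by
    obtain ⟨_, -, hweight⟩ := h₁.weight_bounded
    exact (hweight s t ht).1

theorem Ψ_eq (h : Vec N) :
    reg.Ψ h = quadratic (toCLM reg.V₀) reg.v₀ h + penalty reg.ψ reg.L reg.v h := rfl

theorem stack_mul_diagonal_mul_stack (h : Vec N) :
    reg.stackᵀ * Matrix.diagonal (reg.b h) * reg.stack
      = ∑ s, weight (reg.ψ s) ‖toCLM (reg.V s) h - reg.v s‖ • ((reg.V s)ᵀ * reg.V s) := by
  ext i j
  rw [Matrix.mul_apply, Fintype.sum_sigma, Matrix.sum_apply]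
  refine Finset.sum_congr rfl fun s _ => ?_
  rw [Matrix.smul_apply, Matrix.mul_apply, Finset.smul_sum]
  refine Finset.sum_congr rfl fun k _ => ?_
  rw [Matrix.mul_diagonal, smul_eq_mul, mul_comm _ (reg.b h ⟨s, k⟩), mul_assoc]
  rfl

theorem toCLM_stack_mul_diagonal_mul_stack (h : Vec N) :
    toCLM (reg.stackᵀ * Matrix.diagonal (reg.b h) * reg.stack)
      = penaltyOp reg.ψ reg.L reg.v h := by
  rw [stack_mul_diagonal_mul_stack, map_sum, penaltyOp]
  refine Finset.sum_congr rfl fun s _ => ?_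
  rw [map_smul, adjoint_toCLM]
  congr 1
  ext1 x
  exact toCLM_mul_apply _ _ x

variable (hψ : ∀ s, IsPotential (reg.ψ s))
include hψ

theorem isQuadraticallyMajorized_penalty :
    IsQuadraticallyMajorized (penalty reg.ψ reg.L reg.v) (penaltyOp reg.ψ reg.L reg.v)
      (penaltyVec reg.ψ reg.L reg.v) where
  nonneg := inner_penaltyOp_nonneg hψ
  le := penalty_le hψ
  continuous := continuous_penalty hψ
  continuous_op := continuous_penaltyOp hψ
  continuous_vec := continuous_penaltyVec hψ
  bounded_vec := ⟨_, norm_penaltyVec_le hψ⟩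

theorem posSemidef_stack_mul_diagonal_mul_stack (h : Vec N) :
    (reg.stackᵀ * Matrix.diagonal (reg.b h) * reg.stack).PosSemidef := by
  have hdiag : (Matrix.diagonal (reg.b h)).PosSemidef :=
    Matrix.PosSemidef.diagonal fun i => (hψ i.1).weight_nonneg _ (norm_nonneg _)
  simpa using hdiag.conjTranspose_mul_mul_same reg.stack

theorem continuous_stack_mul_diagonal_mul_stack :
    Continuous fun h : Vec N => reg.stackᵀ * Matrix.diagonal (reg.b h) * reg.stack := by
  have hweight := fun s => (hψ s).continuous_weight
  simp only [stack_mul_diagonal_mul_stack]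
  fun_prop

theorem hasGradientAt_quadratic_add_penalty {A : Matrix (Fin N) (Fin N) ℝ} (hA : A.PosSemidef)
    (c : Vec N) (K : ℝ) (h : Vec N) :
    HasGradientAt (fun z => quadratic (toCLM A) c z + penalty reg.ψ reg.L reg.v z + K)
      (toCLM A h - c + (penaltyOp reg.ψ reg.L reg.v h h - penaltyVec reg.ψ reg.L reg.v h)) h := by
  have hquadratic := hasGradientAt_quadratic (isPositive_toCLM hA).isSymmetric c h
  have hpenalty := hasGradientAt_penalty (L := reg.L) (v := reg.v) hψ h
  rw [hasGradientAt_iff_hasFDerivAt] at *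
  rw [map_add]
  exact (hquadratic.add hpenalty).add_const K

end Regularizer

section Sample

variable {N Q : ℕ} (reg : Regularizer N) (x : ℕ → Matrix (Fin N) (Fin Q) ℝ) (y : ℕ → Vec Q)

/-- The vector `(1/n) ∑_{k ≤ n} X_k y_k + v₀` of the linear part of `F_n` (indices shifted). -/
noncomputable def sampleVec (n : ℕ) : Vec N :=
  sampleMean (fun k => toCLM (x k) (y k)) n + reg.v₀

/-- The data of the quadratic minimization problem that defines `argminSurrogate`. -/
noncomputable def surrogateData (n : ℕ) (h : Vec N) {M : ℕ} (D : Matrix (Fin N) (Fin M) ℝ) :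
    QuadraticData N M :=
  (curvature reg x n h, D, sampleVec reg x y n + penaltyVec reg.ψ reg.L reg.v h)

theorem norm_sub_toCLM_transpose_sq (A : Matrix (Fin N) (Fin Q) ℝ) (w : Vec Q) (h : Vec N) :
    ‖w - toCLM Aᵀ h‖ ^ 2
      = ‖w‖ ^ 2 - 2 * inner ℝ (toCLM A w) h + inner ℝ h (toCLM (A * Aᵀ) h) := by
  rw [norm_sub_sq_real, ← real_inner_self_eq_norm_sq (toCLM Aᵀ h), inner_toCLM_transpose,
    toCLM_mul_apply, real_inner_comm, inner_toCLM_transpose, real_inner_comm]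

theorem posSemidef_sampleR (n : ℕ) : (sampleR x n).PosSemidef := by
  refine Matrix.PosSemidef.smul (Matrix.posSemidef_sum _ fun k _ => ?_) (by positivity)
  simpa using Matrix.posSemidef_self_mul_conjTranspose (x k)

theorem sampleCost_eq (n : ℕ) (h : Vec N) : sampleCost reg x y n h
    = quadratic (toCLM (sampleR x n + reg.V₀)) (sampleVec reg x y n) h
      + penalty reg.ψ reg.L reg.v h
      + (2 * ((n : ℝ) + 1))⁻¹ * ∑ k ∈ Finset.range (n + 1), ‖y k‖ ^ 2 := by
  have hresidual := fun k => norm_sub_toCLM_transpose_sq (x k) (y k) h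
  change (2 * ((n : ℝ) + 1))⁻¹ * ∑ k ∈ Finset.range (n + 1), ‖y k - toCLM (x k)ᵀ h‖ ^ 2 + reg.Ψ h
    = _
  simp only [hresidual, Regularizer.Ψ_eq, quadratic, sampleVec, sampleMean, sampleR, map_add,
    map_smul, map_sum, add_apply, smul_apply, sum_apply, inner_add_left, inner_add_right,
    inner_smul_left, inner_smul_right, inner_sum, sum_inner, conj_trivial,
    Finset.sum_add_distrib, Finset.sum_sub_distrib, ← Finset.mul_sum]
  field_simp
  ring

theorem toCLM_curvature_apply (n : ℕ) (h z : Vec N) : toCLM (curvature reg x n h) z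
    = toCLM (sampleR x n + reg.V₀) z + penaltyOp reg.ψ reg.L reg.v h z := by
  rw [curvature, map_add, Regularizer.toCLM_stack_mul_diagonal_mul_stack, add_apply]

variable {reg} (hψ : ∀ s, IsPotential (reg.ψ s))
include hψ

theorem gradient_sampleCost (n : ℕ) (h : Vec N) :
    ∇ (sampleCost reg x y n) h = toCLM (sampleR x n + reg.V₀) h - sampleVec reg x y n
      + (penaltyOp reg.ψ reg.L reg.v h h - penaltyVec reg.ψ reg.L reg.v h) := by
  rw [funext (sampleCost_eq reg x y n)]
  exact (Regularizer.hasGradientAt_quadratic_add_penalty hψ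
    ((posSemidef_sampleR x n).add reg.posSemidef_V₀) _ _ h).gradient

theorem posSemidef_curvature (n : ℕ) (h : Vec N) : (curvature reg x n h).PosSemidef :=
  ((posSemidef_sampleR x n).add reg.posSemidef_V₀).add
    (Regularizer.posSemidef_stack_mul_diagonal_mul_stack hψ h)

theorem surrogate_eq (n : ℕ) (z h : Vec N) : surrogate reg x y n z h = sampleCost reg x y n h
    + (quadratic (toCLM (curvature reg x n h))
        (sampleVec reg x y n + penaltyVec reg.ψ reg.L reg.v h) z
      - quadratic (toCLM (curvature reg x n h))
        (sampleVec reg x y n + penaltyVec reg.ψ reg.L reg.v h) h) := by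
  have hgradient : ∇ (sampleCost reg x y n) h = toCLM (curvature reg x n h) h
      - (sampleVec reg x y n + penaltyVec reg.ψ reg.L reg.v h) := by
    rw [gradient_sampleCost x y hψ, toCLM_curvature_apply]
    abel
  have hsymm := (isPositive_toCLM (posSemidef_curvature x hψ n h)).isSymmetric
  rw [quadratic_expansion hsymm _ h z, surrogate, hgradient]
  change _ + _ + 1 / 2 * inner ℝ (z - h) (toCLM (curvature reg x n h) (z - h)) = _
  ring

theorem mem_argminSurrogate_iff (n : ℕ) (h : Vec N) {M : ℕ} (D : Matrix (Fin N) (Fin M) ℝ)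
    (z : Vec N) :
    z ∈ argminSurrogate reg x y n h D ↔ z ∈ ran D ∧ ∀ w ∈ ran D,
      inner ℝ (toCLM (curvature reg x n h) z
        - (sampleVec reg x y n + penaltyVec reg.ψ reg.L reg.v h)) w = 0 := by
  refine and_congr_right fun hz => ?_
  rw [← forall_quadratic_le_iff (isPositive_toCLM (posSemidef_curvature x hψ n h)) _ hz]
  simp only [surrogate_eq x y hψ, add_le_add_iff_left, sub_le_sub_iff_right]

theorem not_subsingleton_argminSurrogate {n : ℕ} {h : Vec N} {M : ℕ}
    {D : Matrix (Fin N) (Fin M) ℝ} {z w : Vec N} (hz : z ∈ argminSurrogate reg x y n h D)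
    (hw : w ∈ ran D) (hcurvature : toCLM (curvature reg x n h) w = 0) (hw0 : w ≠ 0) :
    ¬ (argminSurrogate reg x y n h D).Subsingleton := by
  intro hs
  have hzw : z + w ∈ argminSurrogate reg x y n h D := by
    rw [mem_argminSurrogate_iff x y hψ] at hz ⊢
    refine ⟨(ran D).add_mem hz.1 hw, ?_⟩
    rw [map_add, hcurvature, add_zero]
    exact hz.2
  exact hw0 (by simpa using hs hzw hz)

theorem limitSolution_surrogateData_eq {n : ℕ} {h : Vec N} {M : ℕ} {D : Matrix (Fin N) (Fin M) ℝ}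
    {z : Vec N} (hz : z ∈ argminSurrogate reg x y n h D)
    (hcoercive : surrogateData reg x y n h D ∈ QuadraticData.coerciveSet N M) :
    (surrogateData reg x y n h D).limitSolution = z := by
  obtain ⟨hmem, horth⟩ := (mem_argminSurrogate_iff x y hψ n h D z).1 hz
  exact QuadraticData.limitSolution_eq (posSemidef_curvature x hψ n h) hcoercive hmem horth

theorem surrogateData_mem_coerciveSet {n : ℕ} {h : Vec N} {M : ℕ} {D : Matrix (Fin N) (Fin M) ℝ}
    {z : Vec N} (hz : z ∈ argminSurrogate reg x y n h D)
    (hs : (argminSurrogate reg x y n h D).Subsingleton) :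
    surrogateData reg x y n h D ∈ QuadraticData.coerciveSet N M := by
  refine exists_coercive_of_isPositive (isPositive_toCLM (posSemidef_curvature x hψ n h))
    fun w hw hcurvature => ?_
  by_contra hw0
  exact not_subsingleton_argminSurrogate x y hψ hz hw hcurvature hw0 hs

theorem isSubspaceDescent {M : ℕ → ℕ} {D : (n : ℕ) → Matrix (Fin N) (Fin (M n)) ℝ}
    {h : ℕ → Vec N} (hmin : ∀ n, h (n + 1) ∈ argminSurrogate reg x y n (h n) (D n))
    (hmem : ∀ n, ∇ (sampleCost reg x y n) (h n) ∈ ran (D n) ∧ h n ∈ ran (D n)) :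
    IsSubspaceDescent (penaltyOp reg.ψ reg.L reg.v) (penaltyVec reg.ψ reg.L reg.v)
      (fun n => toCLM (sampleR x n + reg.V₀)) (sampleVec reg x y) (fun n => ran (D n)) h where
  symm n := (isPositive_toCLM ((posSemidef_sampleR x n).add reg.posSemidef_V₀)).isSymmetric
  mem n := (hmem n).2
  mem_succ n := (hmin n).1
  gradient_mem n := by
    rw [← gradient_sampleCost x y hψ]
    exact (hmem n).1
  orthogonal n w hw := by
    rw [← ((mem_argminSurrogate_iff x y hψ n (h n) (D n) _).1 (hmin n)).2 w hw,
      toCLM_curvature_apply]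
    congr 1
    abel

end Sample

section DataMeasurability

variable {α : Type*} [MeasurableSpace α] {N Q : ℕ} {reg : Regularizer N}
  {x : ℕ → α → Matrix (Fin N) (Fin Q) ℝ} {y : ℕ → α → Vec Q} {n : ℕ}

theorem measurable_toCLM_apply {l m : ℕ} {A : α → Matrix (Fin l) (Fin m) ℝ} {z : α → Vec m}
    (hA : Measurable A) (hz : Measurable z) : Measurable fun a => toCLM (A a) (z a) := by
  have happly : Measurable fun q : Matrix (Fin l) (Fin m) ℝ × Vec m => toCLM q.1 q.2 :=
    ((continuous_toCLM.comp continuous_fst).clm_apply continuous_snd).measurable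
  have hpair : Measurable fun a => (A a, z a) := hA.prodMk hz
  exact (happly.comp hpair :)

theorem measurable_sampleVec (hx : ∀ k ≤ n, Measurable (x k)) (hy : ∀ k ≤ n, Measurable (y k)) :
    Measurable fun a => sampleVec reg (x · a) (y · a) n := by
  have hsum : Measurable fun a => ∑ k ∈ Finset.range (n + 1), toCLM (x k a) (y k a) := by
    refine Finset.measurable_fun_sum _ fun k hk => ?_
    have hk' := Finset.mem_range_succ_iff.1 hk
    exact measurable_toCLM_apply (hx k hk') (hy k hk')
  exact (hsum.const_smul ((n : ℝ) + 1)⁻¹).add_const reg.v₀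

theorem measurable_sampleR (hx : ∀ k ≤ n, Measurable (x k)) :
    Measurable fun a => sampleR (x · a) n := by
  have hsquare : Continuous fun A : Matrix (Fin N) (Fin Q) ℝ => A * Aᵀ := by fun_prop
  have hsum : Measurable fun a => ∑ k ∈ Finset.range (n + 1), x k a * (x k a)ᵀ :=
    Finset.measurable_fun_sum _ fun k hk =>
      hsquare.measurable.comp (hx k (Finset.mem_range_succ_iff.1 hk))
  exact hsum.const_smul ((n : ℝ) + 1)⁻¹

theorem measurable_surrogateData (hψ : ∀ s, IsPotential (reg.ψ s))
    (hx : ∀ k ≤ n, Measurable (x k)) (hy : ∀ k ≤ n, Measurable (y k)) {g : α → Vec N}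
    (hg : Measurable g) {M : ℕ} {D : α → Matrix (Fin N) (Fin M) ℝ}
    (hD : ∀ i j, Measurable fun a => D a i j) :
    Measurable fun a => surrogateData reg (x · a) (y · a) n (g a) (D a) := by
  have hcurvature : Measurable fun a => curvature reg (x · a) n (g a) :=
    ((measurable_sampleR hx).add_const _).add
      ((Regularizer.continuous_stack_mul_diagonal_mul_stack hψ).measurable.comp hg)
  have hvec : Measurable fun a =>
      sampleVec reg (x · a) (y · a) n + penaltyVec reg.ψ reg.L reg.v (g a) :=
    (measurable_sampleVec hx hy).add ((continuous_penaltyVec hψ).measurable.comp hg)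
  have hsubspace : Measurable D :=
    measurable_pi_lambda _ fun i => measurable_pi_lambda _ fun j => hD i j
  exact hcurvature.prodMk (hsubspace.prodMk hvec)

end DataMeasurability

theorem map_sampleMean {E F : Type*} [AddCommGroup E] [Module ℝ E] [AddCommGroup F] [Module ℝ F]
    (f : E →ₗ[ℝ] F) (x : ℕ → E) (n : ℕ) :
    f (sampleMean x n) = sampleMean (fun k => f (x k)) n := by
  simp only [sampleMean, map_smul, map_sum]

theorem sampleMean_sub_const {E : Type*} [AddCommGroup E] [Module ℝ E] (x : ℕ → E) (a : E)
    (n : ℕ) : sampleMean (fun k => x k - a) n = sampleMean x n - a := by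
  have hn : (n : ℝ) + 1 ≠ 0 := by positivity
  rw [sampleMean, sampleMean, Finset.sum_sub_distrib, Finset.sum_const, Finset.card_range,
    ← Nat.cast_smul_eq_nsmul ℝ, smul_sub, Nat.cast_succ, inv_smul_smul₀ hn]

section ConditionalMean

variable {Ω : Type*} {m0 : MeasurableSpace Ω} {μ : Measure Ω} [IsProbabilityMeasure μ]
  {ℱ : Filtration ℕ m0} {f : ℕ → Ω → ℝ} {a C : ℝ}

theorem isMartingaleDifference_sub_const (hadapted : StronglyAdapted ℱ f)
    (hf : ∀ n, MemLp (f n) 2 μ) (hC : ∀ n, ∫ ω, f n ω ^ 2 ∂μ ≤ C)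
    (hcond : ∀ n, μ[f (n + 1) | ℱ n] =ᵐ[μ] fun _ => a) :
    IsMartingaleDifference ℱ μ (fun n ω => f n ω - a) (2 * C + 2 * a ^ 2) where
  adapted n := (hadapted n).sub stronglyMeasurable_const
  memLp n := (hf n).sub (memLp_const a)
  sq_le n := by
    have hint : Integrable (fun ω => 2 * f n ω ^ 2 + 2 * a ^ 2) μ :=
      ((hf n).integrable_sq.const_mul 2).add (integrable_const _)
    calc ∫ ω, (f n ω - a) ^ 2 ∂μ ≤ ∫ ω, (2 * f n ω ^ 2 + 2 * a ^ 2) ∂μ :=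
          integral_mono ((hf n).sub (memLp_const a)).integrable_sq hint fun ω => by
            change (f n ω - a) ^ 2 ≤ 2 * f n ω ^ 2 + 2 * a ^ 2
            nlinarith [sq_nonneg (f n ω + a)]
      _ = 2 * ∫ ω, f n ω ^ 2 ∂μ + 2 * a ^ 2 := by
          rw [integral_add ((hf n).integrable_sq.const_mul 2) (integrable_const _),
            integral_const_mul, integral_const, probReal_univ, one_smul]
      _ ≤ 2 * C + 2 * a ^ 2 := by linarith [hC n]
  condExp n := by
    filter_upwards [condExp_sub ((hf (n + 1)).integrable one_le_two)
      (integrable_const (μ := μ) a) (ℱ n), hcond n] with ω hsub hmean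
    rw [Pi.sub_apply, hmean, condExp_const (ℱ.le n), sub_self] at hsub
    exact hsub

variable (hf : IsMartingaleDifference ℱ μ (fun n ω => f n ω - a) C)
include hf

theorem ae_tendsto_sampleMean_of_sub_const :
    ∀ᵐ ω ∂μ, Tendsto (sampleMean (f · ω)) atTop (𝓝 a) := by
  filter_upwards [hf.ae_tendsto_sampleMean] with ω hω
  simpa [sampleMean_sub_const] using hω.add_const a

theorem ae_exists_tendsto_sum_mul_increments_of_sub_const {w : ℕ → Ω → ℝ}
    (hw : StronglyAdapted ℱ w) (hK : ∀ᵐ ω ∂μ, ∃ K, ∀ n, |w n ω| ≤ K) :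
    ∀ᵐ ω ∂μ, ∃ l, Tendsto (fun m => ∑ n ∈ Finset.range m,
      w n ω * (sampleMean (f · ω) (n + 1) - sampleMean (f · ω) n)) atTop (𝓝 l) := by
  filter_upwards [hf.ae_exists_tendsto_sum_mul_increments hw hK] with ω hω
  simpa only [sampleMean_sub_const, sub_sub_sub_cancel_right] using hω

end ConditionalMean

section Coordinates

variable {N : ℕ}

theorem inner_eq_sum (c z : Vec N) : inner ℝ c z = ∑ i, z i * c i := by
  simp [PiLp.inner_apply]

theorem inner_toCLM_eq_sum (A : Matrix (Fin N) (Fin N) ℝ) (z : Vec N) :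
    inner ℝ z (toCLM A z) = ∑ i, ∑ j, z i * z j * A i j := by
  rw [real_inner_comm, inner_eq_sum]
  refine Finset.sum_congr rfl fun i _ => ?_
  simp only [toCLM_apply_eq, Matrix.mulVec, dotProduct, Finset.mul_sum]
  exact Finset.sum_congr rfl fun j _ => by ring

variable {Ω : Type*} [MeasurableSpace Ω] {μ : Measure Ω}

theorem integrable_inner {b : Ω → Vec N} (hb : ∀ i, Integrable (fun ω => b ω i) μ) (z : Vec N) :
    Integrable (fun ω => inner ℝ (b ω) z) μ := by
  simp only [inner_eq_sum]
  exact integrable_finsetSum _ fun i _ => (hb i).const_mul _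

theorem integral_inner {b : Ω → Vec N} (hb : ∀ i, Integrable (fun ω => b ω i) μ) (z : Vec N) :
    ∫ ω, inner ℝ (b ω) z ∂μ = inner ℝ (WithLp.toLp 2 fun i => ∫ ω, b ω i ∂μ) z := by
  simp only [inner_eq_sum]
  rw [integral_finsetSum _ fun i _ => (hb i).const_mul _]
  simp only [integral_const_mul]

theorem integrable_inner_toCLM {A : Ω → Matrix (Fin N) (Fin N) ℝ}
    (hA : ∀ i j, Integrable (fun ω => A ω i j) μ) (z : Vec N) :
    Integrable (fun ω => inner ℝ z (toCLM (A ω) z)) μ := by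
  simp only [inner_toCLM_eq_sum]
  exact integrable_finsetSum _ fun i _ => integrable_finsetSum _ fun j _ => (hA i j).const_mul _

theorem integral_inner_toCLM {A : Ω → Matrix (Fin N) (Fin N) ℝ}
    (hA : ∀ i j, Integrable (fun ω => A ω i j) μ) (z : Vec N) :
    ∫ ω, inner ℝ z (toCLM (A ω) z) ∂μ
      = inner ℝ z (toCLM (Matrix.of fun i j => ∫ ω, A ω i j ∂μ) z) := by
  simp only [inner_toCLM_eq_sum]
  rw [integral_finsetSum _ fun i _ => integrable_finsetSum _ fun j _ => (hA i j).const_mul _]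
  refine Finset.sum_congr rfl fun i _ => ?_
  rw [integral_finsetSum _ fun j _ => (hA i j).const_mul _]
  simp only [integral_const_mul, Matrix.of_apply]

end Coordinates

section Observations

variable {Ω : Type*} {N Q : ℕ} {X : ℕ → Ω → Matrix (Fin N) (Fin Q) ℝ} {y : ℕ → Ω → Vec Q}

theorem measurable_dataSigma {k n : ℕ} (hk : k ≤ n) :
    Measurable[dataSigma X y n] fun ω => (X k ω, y k ω) :=
  (comap_measurable _).mono (le_iSup₂_of_le k hk le_rfl) le_rfl

theorem dataSigma_mono : Monotone (dataSigma X y) := fun _ _ hmn =>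
  iSup₂_le fun k hk => le_iSup₂_of_le k (hk.trans hmn) le_rfl

variable [m0 : MeasurableSpace Ω] {μ : Measure Ω}

theorem dataSigma_le (hX : ∀ n, Measurable (X n)) (hy : ∀ n, Measurable (y n)) (n : ℕ) :
    dataSigma X y n ≤ m0 :=
  iSup₂_le fun k _ => ((hX k).prodMk (hy k)).comap_le

/-- The filtration generated by the observations. -/
def dataFiltration (hX : ∀ n, Measurable (X n)) (hy : ∀ n, Measurable (y n)) : Filtration ℕ m0 where
  seq := dataSigma X y
  mono' := dataSigma_mono
  le' := dataSigma_le hX hy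

variable (X y μ) in
/-- The products `X_n X_nᵀ` and `X_n y_n` are bounded in `L²`, and their conditional means given
the past observations are the deterministic moments `R` and `r` of the first observation. -/
structure HasConstantConditionalMoments : Prop where
  integrable_y : Integrable (fun ω => ‖y 0 ω‖ ^ 2) μ
  memLp_XX : ∀ n i j, MemLp (fun ω => (X n ω * (X n ω)ᵀ) i j) 2 μ
  memLp_Xy : ∀ n i, MemLp (fun ω => app (X n ω) (y n ω) i) 2 μ
  bounded_XX : ∀ i j, ∃ C, ∀ n, ∫ ω, (X n ω * (X n ω)ᵀ) i j ^ 2 ∂μ ≤ C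
  bounded_Xy : ∀ i, ∃ C, ∀ n, ∫ ω, app (X n ω) (y n ω) i ^ 2 ∂μ ≤ C
  condExp_XX : ∀ n i j, μ[fun ω => (X (n + 1) ω * (X (n + 1) ω)ᵀ) i j | dataSigma X y n]
    =ᵐ[μ] fun _ => momentXX X μ i j
  condExp_Xy : ∀ n i, μ[fun ω => app (X (n + 1) ω) (y (n + 1) ω) i | dataSigma X y n]
    =ᵐ[μ] fun _ => momentXY X y μ i

section Stationary

open ProbabilityTheory

theorem IsStationaryErgodic.identDistrib (hX : ∀ n, Measurable (X n)) (hy : ∀ n, Measurable (y n))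
    (hst : IsStationaryErgodic X y μ) (n : ℕ) :
    IdentDistrib (fun ω => (X n ω, y n ω)) (fun ω => (X 0 ω, y 0 ω)) μ μ where
  aemeasurable_fst := ((hX n).prodMk (hy n)).aemeasurable
  aemeasurable_snd := ((hX 0).prodMk (hy 0)).aemeasurable
  map_eq := by
    have hseq : Measurable fun ω n => (X n ω, y n ω) :=
      measurable_pi_lambda _ fun n => (hX n).prodMk (hy n)
    have hlaw : ∀ n, μ.map (fun ω => (X n ω, y n ω))
        = (μ.map fun ω n => (X n ω, y n ω)).map fun z => z n := fun n =>
      (Measure.map_map (measurable_pi_apply n) hseq).symm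
    have hshift := Ergodic.toMeasurePreserving hst
    induction n with
    | zero => rfl
    | succ n ih =>
      rw [← ih, hlaw n, ← hshift.map_eq, Measure.map_map (measurable_pi_apply n) hshift.measurable]
      exact hlaw (n + 1)

theorem holderTriple_four_four_two : ENNReal.HolderTriple 4 4 2 where
  inv_add_inv_eq_inv := by
    rw [← two_mul, show (4 : ENNReal) = 2 * 2 by norm_num, ENNReal.mul_inv (by simp) (by simp),
      ← mul_assoc, ENNReal.mul_inv_cancel (by simp) (by simp), one_mul]

theorem memLp_mul_transpose {A : Ω → Matrix (Fin N) (Fin Q) ℝ}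
    (hA : ∀ i j, MemLp (fun ω => A ω i j) 4 μ) (i j : Fin N) :
    MemLp (fun ω => (A ω * (A ω)ᵀ) i j) 2 μ := by
  have := holderTriple_four_four_two
  simp only [Matrix.mul_apply, Matrix.transpose_apply]
  exact memLp_finsetSum _ fun k _ => (hA j k).mul (hA i k)

theorem memLp_toCLM_apply {A : Ω → Matrix (Fin N) (Fin Q) ℝ} {b : Ω → Vec Q}
    (hA : ∀ i j, MemLp (fun ω => A ω i j) 4 μ) (hb : ∀ i, MemLp (fun ω => b ω i) 4 μ)
    (i : Fin N) : MemLp (fun ω => toCLM (A ω) (b ω) i) 2 μ := by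
  have := holderTriple_four_four_two
  simp only [toCLM_apply_eq, Matrix.mulVec, dotProduct]
  exact memLp_finsetSum _ fun k _ => (hb k).mul (hA i k)

theorem Assumption3.hasConstantConditionalMoments [IsProbabilityMeasure μ] {reg : Regularizer N}
    {M : ℕ → ℕ} {D : (n : ℕ) → Ω → Matrix (Fin N) (Fin (M n)) ℝ} {h : ℕ → Ω → Vec N}
    (hX : ∀ n, Measurable (X n)) (hy : ∀ n, Measurable (y n))
    (h₃ : Assumption3 X y μ reg M D h) : HasConstantConditionalMoments X y μ where
  integrable_y := by
    simp only [EuclideanSpace.norm_sq_eq, Real.norm_eq_abs, sq_abs]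
    exact integrable_finsetSum _ fun i _ =>
      ((h₃.moment_y 0 i).mono_exponent (p := 2) (by norm_num)).integrable_sq
  memLp_XX n := memLp_mul_transpose (h₃.moment_X n)
  memLp_Xy n := memLp_toCLM_apply (h₃.moment_X n) (h₃.moment_y n)
  bounded_XX i j := by
    have hφ : Continuous fun q : Matrix (Fin N) (Fin Q) ℝ × Vec Q =>
        (q.1 * (q.1)ᵀ) i j ^ 2 := by fun_prop
    exact ⟨_, fun n => ((h₃.stationary_ergodic.identDistrib hX hy n).comp
      hφ.measurable).integral_eq.le⟩
  bounded_Xy i := by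
    have hφ : Continuous fun q : Matrix (Fin N) (Fin Q) ℝ × Vec Q => toCLM q.1 q.2 i ^ 2 :=
      ((EuclideanSpace.proj (𝕜 := ℝ) i).continuous.comp
        ((continuous_toCLM.comp continuous_fst).clm_apply continuous_snd)).pow 2
    exact ⟨_, fun n => ((h₃.stationary_ergodic.identDistrib hX hy n).comp
      hφ.measurable).integral_eq.le⟩
  condExp_XX := h₃.condExp_XX
  condExp_Xy := h₃.condExp_Xy

end Stationary

variable [IsProbabilityMeasure μ]

namespace HasConstantConditionalMoments

variable (hm : HasConstantConditionalMoments X y μ)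
include hm

theorem cost_eq (reg : Regularizer N) (h : Vec N) : cost X y μ reg h
    = quadratic (toCLM (momentXX X μ + reg.V₀)) (momentXY X y μ + reg.v₀) h
      + penalty reg.ψ reg.L reg.v h + 1 / 2 * momentY y μ := by
  have hXX : ∀ i j, Integrable (fun ω => (X 0 ω * (X 0 ω)ᵀ) i j) μ := fun i j =>
    (hm.memLp_XX 0 i j).integrable one_le_two
  have hXy : ∀ i, Integrable (fun ω => toCLM (X 0 ω) (y 0 ω) i) μ := fun i =>
    (hm.memLp_Xy 0 i).integrable one_le_two
  have hlinear := (integrable_inner hXy h).const_mul 2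
  have hdiff : Integrable
      (fun ω => ‖y 0 ω‖ ^ 2 - 2 * inner ℝ (toCLM (X 0 ω) (y 0 ω)) h) μ :=
    hm.integrable_y.sub hlinear
  have hresidual : ∫ ω, ‖y 0 ω - toCLM (X 0 ω)ᵀ h‖ ^ 2 ∂μ
      = momentY y μ - 2 * inner ℝ (momentXY X y μ) h + inner ℝ h (toCLM (momentXX X μ) h) := by
    simp only [norm_sub_toCLM_transpose_sq]
    rw [integral_add hdiff (integrable_inner_toCLM hXX h),
      integral_sub hm.integrable_y hlinear, integral_const_mul, integral_inner hXy,
      integral_inner_toCLM hXX]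
    rfl
  change 1 / 2 * ∫ ω, ‖y 0 ω - toCLM (X 0 ω)ᵀ h‖ ^ 2 ∂μ + reg.Ψ h = _
  simp only [hresidual, Regularizer.Ψ_eq, quadratic, map_add, add_apply, inner_add_left,
    inner_add_right]
  ring

theorem hasGradientAt_cost {reg : Regularizer N} (hψ : ∀ s, IsPotential (reg.ψ s))
    (hR : (momentXX X μ + reg.V₀).PosSemidef) (z : Vec N) :
    HasGradientAt (cost X y μ reg)
      (toCLM (momentXX X μ + reg.V₀) z - (momentXY X y μ + reg.v₀)
        + (penaltyOp reg.ψ reg.L reg.v z z - penaltyVec reg.ψ reg.L reg.v z)) z := by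
  rw [funext (hm.cost_eq reg)]
  exact Regularizer.hasGradientAt_quadratic_add_penalty hψ hR _ _ z

theorem cost_lt_of_hasGradientAt_zero {reg : Regularizer N} (hψ : ∀ s, IsPotential (reg.ψ s))
    (hconvex : ∀ s, ConvexOn ℝ univ (reg.ψ s)) (hR : (momentXX X μ + reg.V₀).PosDef)
    {z z' : Vec N} (hz : HasGradientAt (cost X y μ reg) 0 z) (hne : z' ≠ z) :
    cost X y μ reg z < cost X y μ reg z' := by
  obtain ⟨α, hα, hpos⟩ := exists_coercive_of_posDef hR
  have hlt := quadratic_add_lt_of_critical (isPositive_toCLM hR.posSemidef).isSymmetric _ hα hpos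
    (le_penalty_of_convexOn hψ hconvex z)
    ((hm.hasGradientAt_cost hψ hR.posSemidef z).unique hz) hne
  rw [hm.cost_eq, hm.cost_eq]
  linarith

variable (hX : ∀ n, Measurable (X n)) (hy : ∀ n, Measurable (y n))

theorem isMartingaleDifference_XX (i j : Fin N) :
    ∃ C, IsMartingaleDifference (dataFiltration hX hy) μ
      (fun n ω => (X n ω * (X n ω)ᵀ) i j - momentXX X μ i j) C := by
  obtain ⟨C, hC⟩ := hm.bounded_XX i j
  have hentry : Continuous fun q : Matrix (Fin N) (Fin Q) ℝ × Vec Q => (q.1 * (q.1)ᵀ) i j := by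
    fun_prop
  have hadapted : StronglyAdapted (dataFiltration hX hy) fun n ω => (X n ω * (X n ω)ᵀ) i j :=
    fun n => (hentry.measurable.comp (measurable_dataSigma le_rfl)).stronglyMeasurable
  exact ⟨_, isMartingaleDifference_sub_const hadapted (fun n => hm.memLp_XX n i j) hC
    fun n => hm.condExp_XX n i j⟩

theorem isMartingaleDifference_Xy (i : Fin N) :
    ∃ C, IsMartingaleDifference (dataFiltration hX hy) μ
      (fun n ω => toCLM (X n ω) (y n ω) i - momentXY X y μ i) C := by
  obtain ⟨C, hC⟩ := hm.bounded_Xy i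
  have hentry : Continuous fun q : Matrix (Fin N) (Fin Q) ℝ × Vec Q => toCLM q.1 q.2 i :=
    (EuclideanSpace.proj (𝕜 := ℝ) i).continuous.comp
      ((continuous_toCLM.comp continuous_fst).clm_apply continuous_snd)
  have hadapted : StronglyAdapted (dataFiltration hX hy) fun n ω => toCLM (X n ω) (y n ω) i :=
    fun n => (hentry.measurable.comp (measurable_dataSigma le_rfl)).stronglyMeasurable
  exact ⟨_, isMartingaleDifference_sub_const hadapted (fun n => hm.memLp_Xy n i) hC
    fun n => hm.condExp_Xy n i⟩

end HasConstantConditionalMoments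

end Observations

theorem abs_apply_le_norm {N : ℕ} (z : Vec N) (i : Fin N) : |z i| ≤ ‖z‖ := by
  simpa using PiLp.norm_apply_le z i

theorem quadratic_toCLM_eq_sum {N : ℕ} (A : Matrix (Fin N) (Fin N) ℝ) (c z : Vec N) :
    quadratic (toCLM A) c z
      = 1 / 2 * ∑ i, ∑ j, z i * z j * A i j - ∑ i, z i * c i := by
  rw [quadratic, inner_toCLM_eq_sum, inner_eq_sum]

theorem exists_abs_sum_quadratic_le {N : ℕ} {A : ℕ → Matrix (Fin N) (Fin N) ℝ} {c z : ℕ → Vec N}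
    (hA : ∀ i j, ∃ l, Tendsto (fun m => ∑ n ∈ Finset.range m, z n i * z n j * A n i j) atTop (𝓝 l))
    (hc : ∀ i, ∃ l, Tendsto (fun m => ∑ n ∈ Finset.range m, z n i * c n i) atTop (𝓝 l)) :
    ∃ K, ∀ m, |∑ n ∈ Finset.range m, quadratic (toCLM (A n)) (c n) (z n)| ≤ K := by
  choose a ha using hA
  choose b hb using hc
  have hlim : Tendsto (fun m => 1 / 2 * ∑ i, ∑ j, ∑ n ∈ Finset.range m, z n i * z n j * A n i j
      - ∑ i, ∑ n ∈ Finset.range m, z n i * c n i) atTop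
      (𝓝 (1 / 2 * ∑ i, ∑ j, a i j - ∑ i, b i)) :=
    ((tendsto_finsetSum _ fun i _ => tendsto_finsetSum _ fun j _ => ha i j).const_mul _).sub
      (tendsto_finsetSum _ fun i _ => hb i)
  have hsum : ∀ m, ∑ n ∈ Finset.range m, quadratic (toCLM (A n)) (c n) (z n)
      = 1 / 2 * ∑ i, ∑ j, ∑ n ∈ Finset.range m, z n i * z n j * A n i j
        - ∑ i, ∑ n ∈ Finset.range m, z n i * c n i := fun m => by
    simp only [quadratic_toCLM_eq_sum, Finset.sum_sub_distrib, ← Finset.mul_sum]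
    refine congrArg₂ (fun s t => 1 / 2 * s - t) ?_ Finset.sum_comm
    exact Finset.sum_comm.trans (Finset.sum_congr rfl fun i _ => Finset.sum_comm)
  obtain ⟨K, hK⟩ := hlim.abs.bddAbove_range
  exact ⟨K, fun m => (congrArg abs (hsum m)).trans_le (hK (mem_range_self m))⟩

section Iterates

variable {Ω : Type*} {N Q : ℕ} {X : ℕ → Ω → Matrix (Fin N) (Fin Q) ℝ} {y : ℕ → Ω → Vec Q}
  [MeasurableSpace Ω] {μ : Measure Ω} {reg : Regularizer N} {M : ℕ → ℕ}
  {D : (n : ℕ) → Ω → Matrix (Fin N) (Fin (M n)) ℝ} {h : ℕ → Ω → Vec N}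

namespace IsMMSubspaceSequence

variable (hh : IsMMSubspaceSequence X y μ reg M D h) (hψ : ∀ s, IsPotential (reg.ψ s))
  (hD : ∀ n i j, Measurable[dataSigma X y n] fun ω => D n ω i j)
include hh hψ hD

theorem exists_measurable_succ {n : ℕ} {g : Ω → Vec N} (hg : Measurable[dataSigma X y n] g)
    (hgh : h n =ᵐ[μ] g) :
    ∃ g' : Ω → Vec N, Measurable[dataSigma X y n] g' ∧ h (n + 1) =ᵐ[μ] g' := by
  classical
  obtain ⟨f, hf, hfh⟩ := hh.selection n
  let q : Ω → QuadraticData N (M n) := fun ω => surrogateData reg (X · ω) (y · ω) n (g ω) (D n ω)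
  have hq : Measurable[dataSigma X y n] q :=
    @measurable_surrogateData Ω (dataSigma X y n) N Q reg X y n hψ
      (fun k hk => (measurable_dataSigma hk).fst) (fun k hk => (measurable_dataSigma hk).snd)
      g hg (M n) (D n) (hD n)
  refine ⟨fun ω => if q ω ∈ QuadraticData.coerciveSet N (M n) then (q ω).limitSolution else f ω,
    Measurable.ite (hq QuadraticData.measurableSet_coerciveSet)
      (QuadraticData.measurable_limitSolution.comp hq) hf, ?_⟩
  filter_upwards [hh.mem_argmin, hfh, hgh] with ω hmin hsel hω
  have hmin := hmin n
  rw [hω] at hmin hsel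
  split_ifs with hcoercive
  · exact (limitSolution_surrogateData_eq _ _ hψ hmin hcoercive).symm
  · exact hsel fun hs => hcoercive (surrogateData_mem_coerciveSet _ _ hψ hmin hs)

theorem exists_measurable_iterates (h0 : Measurable[dataSigma X y 0] (h 0)) :
    ∃ g : ℕ → Ω → Vec N, (∀ n, Measurable[dataSigma X y n] (g n)) ∧
      ∀ᵐ ω ∂μ, ∀ n, h (n + 1) ω = g n ω := by
  have hex : ∀ n, ∃ g : Ω → Vec N, Measurable[dataSigma X y n] g ∧ h n =ᵐ[μ] g := fun n => by
    induction n with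
    | zero => exact ⟨h 0, h0, EventuallyEq.rfl⟩
    | succ n ih =>
      obtain ⟨g, hg, hgh⟩ := ih
      obtain ⟨g', hg', hgh'⟩ := hh.exists_measurable_succ hψ hD hg hgh
      exact ⟨g', hg'.mono (dataSigma_mono n.le_succ) le_rfl, hgh'⟩
  choose f hf hfh using hex
  choose g hg hgh using fun n => hh.exists_measurable_succ hψ hD (hf n) (hfh n)
  exact ⟨g, hg, ae_all_iff.2 hgh⟩

end IsMMSubspaceSequence

theorem sampleR_apply (x : ℕ → Matrix (Fin N) (Fin Q) ℝ) (n : ℕ) (i j : Fin N) :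
    sampleR x n i j = sampleMean (fun k => (x k * (x k)ᵀ) i j) n :=
  map_sampleMean (Matrix.entryLinearMap ℝ ℝ i j) (fun k => x k * (x k)ᵀ) n

theorem sampleVec_apply (x : ℕ → Matrix (Fin N) (Fin Q) ℝ) (w : ℕ → Vec Q) (n : ℕ) (i : Fin N) :
    sampleVec reg x w n i = sampleMean (fun k => toCLM (x k) (w k) i) n + reg.v₀ i :=
  congrArg (· + reg.v₀ i)
    (map_sampleMean (EuclideanSpace.proj (𝕜 := ℝ) i).toLinearMap (fun k => toCLM (x k) (w k)) n)

namespace HasConstantConditionalMoments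

variable [IsProbabilityMeasure μ] (hm : HasConstantConditionalMoments X y μ)
  (hX : ∀ n, Measurable (X n)) (hy : ∀ n, Measurable (y n))
include hm hX hy

theorem ae_tendsto_sampleR :
    ∀ᵐ ω ∂μ, Tendsto (sampleR (X · ω)) atTop (𝓝 (momentXX X μ)) := by
  have hentry : ∀ᵐ ω ∂μ, ∀ i j, Tendsto (sampleMean fun n => (X n ω * (X n ω)ᵀ) i j) atTop
      (𝓝 (momentXX X μ i j)) := by
    refine ae_all_iff.2 fun i => ae_all_iff.2 fun j => ?_
    obtain ⟨C, hC⟩ := hm.isMartingaleDifference_XX hX hy i j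
    exact ae_tendsto_sampleMean_of_sub_const hC
  filter_upwards [hentry] with ω hω
  refine tendsto_pi_nhds.2 fun i => tendsto_pi_nhds.2 fun j => ?_
  exact (hω i j).congr fun n => (sampleR_apply _ n i j).symm

theorem ae_tendsto_sampleVec :
    ∀ᵐ ω ∂μ, Tendsto (sampleVec reg (X · ω) (y · ω)) atTop (𝓝 (momentXY X y μ + reg.v₀)) := by
  have hentry : ∀ᵐ ω ∂μ, ∀ i, Tendsto (sampleMean fun n => toCLM (X n ω) (y n ω) i) atTop
      (𝓝 (momentXY X y μ i)) := by
    refine ae_all_iff.2 fun i => ?_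
    obtain ⟨C, hC⟩ := hm.isMartingaleDifference_Xy hX hy i
    exact ae_tendsto_sampleMean_of_sub_const hC
  filter_upwards [hentry] with ω hω
  have hcoord : Tendsto (fun n => (sampleVec reg (X · ω) (y · ω) n).ofLp) atTop
      (𝓝 (momentXY X y μ + reg.v₀).ofLp) := tendsto_pi_nhds.2 fun i =>
    ((hω i).add_const (reg.v₀ i)).congr fun n => (sampleVec_apply _ _ n i).symm
  exact ((PiLp.continuous_toLp 2 _).tendsto _).comp hcoord

section Increments

variable {g : ℕ → Ω → Vec N} (hg : ∀ n, Measurable[dataSigma X y n] (g n))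
  (hbounded : ∀ᵐ ω ∂μ, Bornology.IsBounded (range (g · ω)))
include hg hbounded

theorem ae_exists_tendsto_sum_sampleR_increments (i j : Fin N) :
    ∀ᵐ ω ∂μ, ∃ l, Tendsto (fun m => ∑ n ∈ Finset.range m,
      g n ω i * g n ω j * (sampleR (X · ω) (n + 1) - sampleR (X · ω) n) i j) atTop (𝓝 l) := by
  obtain ⟨C, hC⟩ := hm.isMartingaleDifference_XX hX hy i j
  have hadapted : StronglyAdapted (dataFiltration hX hy) fun n ω => g n ω i * g n ω j := fun n =>
    have hcoord := fun i => (EuclideanSpace.proj (𝕜 := ℝ) i).measurable.comp (hg n)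
    ((hcoord i).mul (hcoord j)).stronglyMeasurable
  have hweight : ∀ᵐ ω ∂μ, ∃ K, ∀ n, |g n ω i * g n ω j| ≤ K := by
    filter_upwards [hbounded] with ω hω
    obtain ⟨K, hK⟩ := isBounded_iff_forall_norm_le.1 hω
    refine ⟨K * K, fun n => ?_⟩
    have hgK := hK _ (mem_range_self n)
    rw [abs_mul]
    exact mul_le_mul ((abs_apply_le_norm _ i).trans hgK) ((abs_apply_le_norm _ j).trans hgK)
      (abs_nonneg _) ((norm_nonneg _).trans hgK)
  simp only [Matrix.sub_apply, sampleR_apply]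
  exact ae_exists_tendsto_sum_mul_increments_of_sub_const hC hadapted hweight

theorem ae_exists_tendsto_sum_sampleVec_increments (i : Fin N) :
    ∀ᵐ ω ∂μ, ∃ l, Tendsto (fun m => ∑ n ∈ Finset.range m, g n ω i *
      (sampleVec reg (X · ω) (y · ω) (n + 1) - sampleVec reg (X · ω) (y · ω) n) i)
      atTop (𝓝 l) := by
  obtain ⟨C, hC⟩ := hm.isMartingaleDifference_Xy hX hy i
  have hadapted : StronglyAdapted (dataFiltration hX hy) fun n ω => g n ω i := fun n =>
    ((EuclideanSpace.proj (𝕜 := ℝ) i).measurable.comp (hg n)).stronglyMeasurable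
  have hweight : ∀ᵐ ω ∂μ, ∃ K, ∀ n, |g n ω i| ≤ K := by
    filter_upwards [hbounded] with ω hω
    obtain ⟨K, hK⟩ := isBounded_iff_forall_norm_le.1 hω
    exact ⟨K, fun n => (abs_apply_le_norm _ i).trans (hK _ (mem_range_self n))⟩
  simp only [PiLp.sub_apply, sampleVec_apply, add_sub_add_right_eq_sub]
  exact ae_exists_tendsto_sum_mul_increments_of_sub_const hC hadapted hweight

theorem ae_exists_abs_sum_quadratic_increments_le :
    ∀ᵐ ω ∂μ, ∃ K, ∀ m, |∑ n ∈ Finset.range m,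
      quadratic (toCLM (sampleR (X · ω) (n + 1) - sampleR (X · ω) n))
        (sampleVec reg (X · ω) (y · ω) (n + 1) - sampleVec reg (X · ω) (y · ω) n) (g n ω)|
      ≤ K := by
  have hR := ae_all_iff.2 fun i => ae_all_iff.2 fun j =>
    hm.ae_exists_tendsto_sum_sampleR_increments hX hy hg hbounded i j
  have hr := ae_all_iff.2 fun i =>
    hm.ae_exists_tendsto_sum_sampleVec_increments (reg := reg) hX hy hg hbounded i
  filter_upwards [hR, hr] with ω hωR hωr
  exact exists_abs_sum_quadratic_le hωR hωr

end Increments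

theorem ae_clusterPoints_properties (hh : IsMMSubspaceSequence X y μ reg M D h)
    (hψ : ∀ s, IsPotential (reg.ψ s)) (h₂ : Assumption2 X y μ reg M D h)
    (hR : (momentXX X μ + reg.V₀).PosDef) (h0 : Measurable[dataSigma X y 0] (h 0))
    (hD : ∀ n i j, Measurable[dataSigma X y n] fun ω => D n ω i j) :
    ∀ᵐ ω ∂μ, Bornology.IsBounded (range (h · ω)) ∧ IsPreconnected (clusterPoints (h · ω)) ∧
      ∀ z ∈ clusterPoints (h · ω), HasGradientAt (cost X y μ reg) 0 z := by
  obtain ⟨α, hα, hpos⟩ := exists_coercive_of_posDef hR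
  obtain ⟨g, hg, hgh⟩ := hh.exists_measurable_iterates hψ hD h0
  have hΦ := Regularizer.isQuadraticallyMajorized_penalty hψ
  have hdescent : ∀ᵐ ω ∂μ, IsSubspaceDescent (penaltyOp reg.ψ reg.L reg.v)
      (penaltyVec reg.ψ reg.L reg.v) (fun n => toCLM (sampleR (X · ω) n + reg.V₀))
      (sampleVec reg (X · ω) (y · ω)) (fun n => ran (D n ω)) (h · ω) := by
    filter_upwards [hh.mem_argmin, h₂] with ω hmin hmem
    exact isSubspaceDescent _ _ hψ hmin hmem
  have hB : ∀ᵐ ω ∂μ, Tendsto (fun n => toCLM (sampleR (X · ω) n + reg.V₀)) atTop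
      (𝓝 (toCLM (momentXX X μ + reg.V₀))) := by
    filter_upwards [hm.ae_tendsto_sampleR hX hy] with ω hω
    exact (continuous_toCLM.tendsto _).comp (hω.add_const _)
  have hc := hm.ae_tendsto_sampleVec (reg := reg) hX hy
  have hbounded : ∀ᵐ ω ∂μ, Bornology.IsBounded (range (g · ω)) := by
    filter_upwards [hdescent, hB, hc, hgh] with ω hdescent hB hc hgh
    refine (hdescent.isBounded_range hα hB hpos hc hΦ).subset (range_subset_iff.2 fun n => ?_)
    exact ⟨n + 1, hgh n⟩
  filter_upwards [hdescent, hB, hc, hgh,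
    hm.ae_exists_abs_sum_quadratic_increments_le (reg := reg) hX hy hg hbounded]
    with ω hdescent hB hc hgh hsum
  have hsum' : ∃ K, ∀ m, |∑ n ∈ Finset.range m,
      quadratic (toCLM (sampleR (X · ω) (n + 1) + reg.V₀) - toCLM (sampleR (X · ω) n + reg.V₀))
        (sampleVec reg (X · ω) (y · ω) (n + 1) - sampleVec reg (X · ω) (y · ω) n) (h (n + 1) ω)|
      ≤ K := by
    simpa only [← map_sub, add_sub_add_right_eq_sub, hgh] using hsum
  obtain ⟨hb, hconnected, hcritical⟩ := hdescent.clusterPoints_properties hα hB hpos hc hΦ hsum'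
  refine ⟨hb, hconnected, fun z hz => ?_⟩
  rw [← hcritical z hz]
  exact hm.hasGradientAt_cost hψ hR.posSemidef z

end HasConstantConditionalMoments

end Iterates

end OnlineMM

theorem proposition2_general {Ω : Type*} [MeasurableSpace Ω] (μ : Measure Ω)
    [IsProbabilityMeasure μ] {N Q : ℕ} (reg : OnlineMM.Regularizer N)
    (X : ℕ → Ω → Matrix (Fin N) (Fin Q) ℝ) (y : ℕ → Ω → OnlineMM.Vec Q)
    (hX : ∀ n, Measurable (X n)) (hy : ∀ n, Measurable (y n))
    (M : ℕ → ℕ) (D : (n : ℕ) → Ω → Matrix (Fin N) (Fin (M n)) ℝ) (h : ℕ → Ω → OnlineMM.Vec N)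
    (hh : OnlineMM.IsMMSubspaceSequence X y μ reg M D h)
    (hψ : ∀ s, OnlineMM.IsPotential (reg.ψ s))
    (h₂ : OnlineMM.Assumption2 X y μ reg M D h)
    (hm : OnlineMM.HasConstantConditionalMoments X y μ)
    (hR : (OnlineMM.momentXX X μ + reg.V₀).PosDef)
    (h0 : Measurable[OnlineMM.dataSigma X y 0] (h 0))
    (hD : ∀ n i j, Measurable[OnlineMM.dataSigma X y n] fun ω => D n ω i j) :
    (∀ᵐ ω ∂μ,
      (OnlineMM.clusterPoints (h · ω)).Nonempty ∧
      IsCompact (OnlineMM.clusterPoints (h · ω)) ∧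
      IsConnected (OnlineMM.clusterPoints (h · ω))) ∧
    (∀ᵐ ω ∂μ, ∀ z ∈ OnlineMM.clusterPoints (h · ω),
      HasGradientAt (OnlineMM.cost X y μ reg) 0 z) ∧
    ((∀ s, ConvexOn ℝ Set.univ (reg.ψ s)) →
      ∃ z : OnlineMM.Vec N,
        (∀ z', z' ≠ z → OnlineMM.cost X y μ reg z < OnlineMM.cost X y μ reg z') ∧
        ∀ᵐ ω ∂μ, Tendsto (h · ω) atTop (𝓝 z)) := by
  have key := hm.ae_clusterPoints_properties hX hy hh hψ h₂ hR h0 hD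
  refine ⟨?_, key.mono fun ω hω => hω.2.2, fun hconvex => ?_⟩
  · filter_upwards [key] with ω ⟨hb, hconnected, _⟩
    have hne := OnlineMM.nonempty_clusterPoints hb
    exact ⟨hne, OnlineMM.isCompact_clusterPoints hb, hne, hconnected⟩
  · obtain ⟨ω₀, hb, -, hcritical⟩ := key.exists
    obtain ⟨z, hz⟩ := OnlineMM.nonempty_clusterPoints hb
    have hmin : ∀ z', z' ≠ z → OnlineMM.cost X y μ reg z < OnlineMM.cost X y μ reg z' := fun z' =>
      hm.cost_lt_of_hasGradientAt_zero hψ hconvex hR (hcritical z hz)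
    refine ⟨z, hmin, ?_⟩
    filter_upwards [key] with ω ⟨hb, _, hcritical⟩
    refine OnlineMM.tendsto_of_clusterPoints_subset_singleton hb fun z' hz' => ?_
    by_contra hne
    exact lt_asymm (hmin z' hne) (hm.cost_lt_of_hasGradientAt_zero hψ hconvex hR
      (hcritical z' hz') (Ne.symm hne))

theorem proposition2 {Ω : Type*} [MeasurableSpace Ω] (μ : Measure Ω) [IsProbabilityMeasure μ]
    {N Q : ℕ} (reg : OnlineMM.Regularizer N)
    (X : ℕ → Ω → Matrix (Fin N) (Fin Q) ℝ) (y : ℕ → Ω → OnlineMM.Vec Q)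
    (hX : ∀ n, Measurable (X n)) (hy : ∀ n, Measurable (y n))
    (M : ℕ → ℕ) (D : (n : ℕ) → Ω → Matrix (Fin N) (Fin (M n)) ℝ) (h : ℕ → Ω → OnlineMM.Vec N)
    (hh : OnlineMM.IsMMSubspaceSequence X y μ reg M D h)
    (h₁ : reg.Assumption1)
    (h₂ : OnlineMM.Assumption2 X y μ reg M D h)
    (h₃ : OnlineMM.Assumption3 X y μ reg M D h) :
    (∀ᵐ ω ∂μ,
      (OnlineMM.clusterPoints (h · ω)).Nonempty ∧
      IsCompact (OnlineMM.clusterPoints (h · ω)) ∧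
      IsConnected (OnlineMM.clusterPoints (h · ω))) ∧
    (∀ᵐ ω ∂μ, ∀ z ∈ OnlineMM.clusterPoints (h · ω),
      HasGradientAt (OnlineMM.cost X y μ reg) 0 z) ∧
    ((∀ s, ConvexOn ℝ Set.univ (reg.ψ s)) →
      ∃ z : OnlineMM.Vec N,
        (∀ z', z' ≠ z → OnlineMM.cost X y μ reg z < OnlineMM.cost X y μ reg z') ∧
        ∀ᵐ ω ∂μ, Tendsto (h · ω) atTop (𝓝 z)) :=
  proposition2_general μ reg X y hX hy M D h hh h₁.isPotential h₂
    (h₃.hasConstantConditionalMoments hX hy) h₃.posDef h₃.measurable_init h₃.measurable_D
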